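/- Let $G$ be a compact connected simple Lie group (that is, its Lie algebra $\mathfrak g$ is simple), let $S\subset G$ be a torus, and let $K=C_G(S)$ be its centralizer, with $K\neq G$, so that $M=G/K$ is a generalized flag manifold of positive dimension. Let $\varphi$ be the Killing form of $\mathfrak g$, let $\mathfrak k$ be the Lie algebra of $K$, and let $\mathfrak m=\mathfrak k^{\perp}$ be its $\varphi$-orthogonal complement, identified with the tangent space $T_{eK}M$, on which $K$ acts by $\mathrm{Ad}$. Let $\mathfrak m=\mathfrak m_1\oplus\cdots\oplus\mathfrak m_s$ be a $\varphi$-orthogonal decomposition into pairwise inequivalent irreducible real $K$-modules. The de Siebenthal invariant of $M=G/K$ is $$\mathcal T=\{(i,j,k)\in\{1,\dots,s\}^3 : \varphi([\mathfrak m_i,\mathfrak m_j],\mathfrak m_k)\neq 0\}.$$ Then $\mathcal T=\emptyset$ if and only if $G/K$ is a (compact) isotropy irreducible Hermitian symmetric space, that is, if and only if all of the following hold: (a) $(G,K)$ is a symmetric pair: there is an automorphism $\sigma$ of the Lie group $G$ with $\sigma^2=\mathrm{id}$ and $(G^\sigma)_0\subset K\subset G^\sigma$, where $G^\sigma$ is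 the fixed point group of $\sigma$ and $(G^\sigma)_0$ its identity component; (b) $G/K$ carries a $G$-invariant (integrable) complex structure and a $G$-invariant Riemannian metric that is Hermitian with respect to it; (c) $G/K$ is isotropy irreducible: $\mathfrak m$ is an irreducible real $K$-module. -/

import Mathlib

open scoped Manifold ContDiff

/-- A smooth real Lie group has the regularity under which Mathlib puts the Lie bracket on its
tangent space at the identity. -/
instance lieGroup_minSmoothness {n : ℕ} {G : Type*} [TopologicalSpace G]
    [ChartedSpace (EuclideanSpace ℝ (Fin n)) G] [Group G] [LieGroup (𝓡 n) ∞ G] :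
    LieGroup (𝓡 n) (minSmoothness ℝ 3) G :=
  LieGroup.of_le (n := ∞) (by
    rw [minSmoothness_of_isRCLikeNormedField]
    exact WithTop.coe_le_coe.2 le_top)

noncomputable section

namespace FlagManifold

variable {n : ℕ} {G : Type*} [TopologicalSpace G] [ChartedSpace (EuclideanSpace ℝ (Fin n)) G]
  [Group G]

variable (n) in
/-- `S` is a torus in `G`: the image of an injective Lie group homomorphism from some
`T^d = (S¹)^d`. Smoothness is expressed through the covering `ℝ^d → T^d`, which is a local
diffeomorphism. The case `d = 0` (trivial torus) is allowed here. -/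
def IsTorus (S : Subgroup G) : Prop :=
  ∃ (d : ℕ) (f : (Fin d → Circle) →* G), Function.Injective f ∧
    ContMDiff 𝓘(ℝ, Fin d → ℝ) (𝓡 n) ∞ (fun θ : Fin d → ℝ => f (fun i => Circle.exp (θ i))) ∧
    f.range = S

variable (n) in
/-- The adjoint representation: `Ad a` is the differential at `1` of `x ↦ a x a⁻¹`, which
fixes `1`. -/
def Ad (a : G) : GroupLieAlgebra (𝓡 n) G →L[ℝ] GroupLieAlgebra (𝓡 n) G :=
  mfderiv (𝓡 n) (𝓡 n) (fun x : G => a * x * a⁻¹) 1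

variable (n) in
/-- The Lie algebra `𝔨` of a subgroup `K`, as a subset of `𝔤`: the vectors `X` with
`exp (t X) ∈ K` for all real `t`, where `t ↦ exp (t X)` is the integral curve through `1` of the
left invariant vector field defined by `X`. -/
def lieAlgebraOf (K : Subgroup G) : Set (GroupLieAlgebra (𝓡 n) G) :=
  {X | ∃ γ : ℝ → G, γ 0 = 1 ∧ IsMIntegralCurve (I := 𝓡 n) γ (mulInvariantVectorField X) ∧
    ∀ t, γ t ∈ K}

/-- `V` is invariant under `Ad K`. -/
def IsAdInvariant (K : Subgroup G) (V : Submodule ℝ (GroupLieAlgebra (𝓡 n) G)) : Prop :=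
  ∀ a ∈ K, ∀ X ∈ V, Ad n a X ∈ V

/-- `V` is an irreducible (nonzero) real `K`-module under `Ad`. -/
def IsAdIrreducible (K : Subgroup G) (V : Submodule ℝ (GroupLieAlgebra (𝓡 n) G)) : Prop :=
  IsAdInvariant K V ∧ V ≠ ⊥ ∧
    ∀ W : Submodule ℝ (GroupLieAlgebra (𝓡 n) G), IsAdInvariant K W → W ≤ V → W = ⊥ ∨ W = V

/-- `V` and `W` are equivalent `K`-modules under `Ad`: there is a linear isomorphism `e : V ≃ W`
with `e (Ad a X) = Ad a (e X)` for all `a ∈ K` and `X ∈ V`. -/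
def AdEquivalent (K : Subgroup G) (V W : Submodule ℝ (GroupLieAlgebra (𝓡 n) G)) : Prop :=
  ∃ e : V ≃ₗ[ℝ] W, ∀ a ∈ K, ∀ X Y : V,
    (Y : GroupLieAlgebra (𝓡 n) G) = Ad n a X → (e Y : GroupLieAlgebra (𝓡 n) G) = Ad n a (e X)

variable [LieGroup (𝓡 n) ∞ G]

variable (n) in
/-- `𝔪 = 𝔨^⊥`, the orthogonal complement of `𝔨` in `𝔤` for the Killing form; it is identified
with the tangent space of `G / K` at the base point. -/
def isotropyModule (K : Subgroup G) : Submodule ℝ (GroupLieAlgebra (𝓡 n) G) where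
  carrier := {X | ∀ Y ∈ lieAlgebraOf n K, killingForm ℝ (GroupLieAlgebra (𝓡 n) G) Y X = 0}
  add_mem' hX hX' Y hY := by simp [hX Y hY, hX' Y hY]
  zero_mem' Y _ := by simp
  smul_mem' c X hX Y hY := by simp [hX Y hY]

/-- `𝔪 = 𝔪₁ ⊕ ⋯ ⊕ 𝔪ₛ` is an orthogonal decomposition (for the Killing form) of `𝔪` into
pairwise inequivalent irreducible `K`-modules. -/
structure IsIsotropyDecomposition (K : Subgroup G) {s : ℕ}
    (V : Fin s → Submodule ℝ (GroupLieAlgebra (𝓡 n) G)) : Prop where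
  iSup_eq : ⨆ i, V i = isotropyModule n K
  independent : iSupIndep V
  orthogonal : ∀ i j, i ≠ j → ∀ X ∈ V i, ∀ Y ∈ V j,
    killingForm ℝ (GroupLieAlgebra (𝓡 n) G) X Y = 0
  irreducible : ∀ i, IsAdIrreducible K (V i)
  inequivalent : ∀ i j, i ≠ j → ¬ AdEquivalent K (V i) (V j)

/-- The de Siebenthal invariant `{(i, j, k) : φ([𝔪ᵢ, 𝔪ⱼ], 𝔪ₖ) ≠ 0}`, with `φ` the Killing form. -/
def deSiebenthalInvariant {s : ℕ} (V : Fin s → Submodule ℝ (GroupLieAlgebra (𝓡 n) G)) :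
    Set (Fin s × Fin s × Fin s) :=
  {p | ∃ X ∈ V p.1, ∃ Y ∈ V p.2.1, ∃ Z ∈ V p.2.2,
    killingForm ℝ (GroupLieAlgebra (𝓡 n) G) ⁅X, Y⁆ Z ≠ 0}

variable (n) in
/-- `(G, K)` is a symmetric pair: there is an involutive automorphism `σ` of the Lie group `G`
such that `K` lies between the identity component of the fixed point group of `σ` and the fixed
point group itself. -/
def IsSymmetricPair (K : Subgroup G) : Prop :=
  ∃ σ : G ≃* G, ContMDiff (𝓡 n) (𝓡 n) ∞ σ ∧ (∀ x, σ (σ x) = x) ∧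
    connectedComponentIn {x | σ x = x} 1 ⊆ (K : Set G) ∧ ∀ x ∈ K, σ x = x

/-- `J`, an endomorphism of `𝔤` that vanishes on `𝔨` and preserves `𝔪`, defines a `G`-invariant
complex structure on `G / K`. The last field is integrability: the `𝔪`-component of the Nijenhuis
expression vanishes; equivalently, `𝔨^ℂ ⊕ 𝔪^{1,0}` is a subalgebra of `𝔤^ℂ`. -/
structure IsInvariantComplexStructure (K : Subgroup G)
    (J : GroupLieAlgebra (𝓡 n) G →ₗ[ℝ] GroupLieAlgebra (𝓡 n) G) : Prop where
  map_lieAlgebraOf : ∀ X ∈ lieAlgebraOf n K, J X = 0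
  map_isotropyModule : ∀ X ∈ isotropyModule n K, J X ∈ isotropyModule n K
  sq_eq_neg : ∀ X ∈ isotropyModule n K, J (J X) = -X
  invariant : ∀ a ∈ K, ∀ X ∈ isotropyModule n K, J (Ad n a X) = Ad n a (J X)
  integrable : ∀ X ∈ isotropyModule n K, ∀ Y ∈ isotropyModule n K,
    ⁅J X, J Y⁆ - ⁅X, Y⁆ - J ⁅J X, Y⁆ - J ⁅X, J Y⁆ ∈ lieAlgebraOf n K

/-- The restriction of `B` to `𝔪` is an `Ad K`-invariant inner product, that is, it defines a
`G`-invariant Riemannian metric on `G / K`. -/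
structure IsInvariantMetric (K : Subgroup G)
    (B : LinearMap.BilinForm ℝ (GroupLieAlgebra (𝓡 n) G)) : Prop where
  symm : ∀ X ∈ isotropyModule n K, ∀ Y ∈ isotropyModule n K, B X Y = B Y X
  pos : ∀ X ∈ isotropyModule n K, X ≠ 0 → 0 < B X X
  invariant : ∀ a ∈ K, ∀ X ∈ isotropyModule n K, ∀ Y ∈ isotropyModule n K,
    B (Ad n a X) (Ad n a Y) = B X Y

variable (n) in
/-- `G / K` is a Hermitian symmetric space: `(G, K)` is a symmetric pair, and `G / K` carries a
`G`-invariant complex structure together with a `G`-invariant Riemannian metric that is Hermitian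
for it. -/
def IsHermitianSymmetric (K : Subgroup G) : Prop :=
  IsSymmetricPair n K ∧
    ∃ (J : GroupLieAlgebra (𝓡 n) G →ₗ[ℝ] GroupLieAlgebra (𝓡 n) G)
      (B : LinearMap.BilinForm ℝ (GroupLieAlgebra (𝓡 n) G)),
      IsInvariantComplexStructure K J ∧ IsInvariantMetric K B ∧
      ∀ X ∈ isotropyModule n K, ∀ Y ∈ isotropyModule n K, B (J X) (J Y) = B X Y

end FlagManifold

end

/-! Write `𝔨` and `𝔪` for the Lie algebra of `K` and its orthogonal complement. Since `φ([·,·],·)`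
is trilinear and `𝔪` is the sum of the `𝔪ᵢ`, the invariant is empty exactly when `φ([𝔪, 𝔪], 𝔪) = 0`.
The group is compact with simple Lie algebra, so `φ` is negative definite (`killingForm_neg`) and
the condition says `[𝔪, 𝔪] ⊆ 𝔨`.

For a symmetric pair, the differential of the involution is `-1` on `𝔪` and its fixed vectors lie in
`𝔨`; hence `[𝔪, 𝔪] ⊆ 𝔨` and the invariant is empty (`lie_mem_lieAlgebraOf_of_isSymmetricPair`).

Conversely, let `[𝔪, 𝔪] ⊆ 𝔨`. A nonzero `𝔨`-submodule `V` of `𝔪` generates the ideal `V + [V, V]`,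
which is all of `𝔤` by simplicity; comparing components in `𝔪` gives `V = 𝔪` (`eq_of_lie_stable`).
So `𝔪` is irreducible. For a generator `X` of the torus that acts nontrivially on `𝔪`, the symmetric
operator `(ad X)²` commutes with `Ad K`, hence is a negative scalar on `𝔪`, and rescaling makes it
`-1` (`exists_lie_lie_eq_neg`). Then `J = ad X` and `-φ` give the Hermitian structure, and
conjugation by `a = exp (πX)` is the involution, because `Ad a = 1 + 2 (ad X)²`.

The delicate point is that the identity component of the centralizer of `a` lies in `K`. For `x` in
it, `φ(Ad x X, X) - φ(X, X)` is continuous in `x`, takes values in `2ℕ` and vanishes at `1`; so it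
is zero, and definiteness forces `Ad x X = X` (`Ad_eq_self_of_mem_connectedComponentIn`). By
irreducibility every generator of `S` is a multiple of `X`, so `x` centralizes `S`. All of this
rests on `d(Ad) = ad` (`exists_hasMFDerivAt_AdE_one`). -/

set_option linter.unusedSectionVars false

/-! ### The differential of the adjoint representation for a local multiplication. -/

noncomputable section

namespace FlagManifold

open Set Filter Topology VectorField

/-- The bracket of the fields `u ↦ D₂μ(u, p) X` and `u ↦ D₂μ(u, p) Y` attached to a local
multiplication `μ` is the derivative of the local adjoint representation `A`. -/
lemma fderiv_localAd_eq_lieBracket {E : Type*} [NormedAddCommGroup E] [NormedSpace ℝ E]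
    {μ : E × E → E} {p : E} (hμ : ContDiffAt ℝ 2 μ (p, p)) {A : E → E →L[ℝ] E}
    (hA : DifferentiableAt ℝ A p) (hAp : A p = ContinuousLinearMap.id ℝ E)
    (hl : ∀ Z, fderiv ℝ μ (p, p) (Z, 0) = Z) (hr : ∀ Z, fderiv ℝ μ (p, p) (0, Z) = Z)
    (X Y : E)
    (h : ∀ᶠ u in 𝓝 p, fderiv ℝ μ (p, u) (A u Y, 0) = fderiv ℝ μ (u, p) (0, Y)) :
    fderiv ℝ A p X Y =
      lieBracket ℝ (fun u => fderiv ℝ μ (u, p) (0, X)) (fun u => fderiv ℝ μ (u, p) (0, Y)) p := by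
  have hsymm : IsSymmSndFDerivAt ℝ μ (p, p) := hμ.isSymmSndFDerivAt (by simp)
  have hd : DifferentiableAt ℝ (fderiv ℝ μ) (p, p) :=
    (hμ.fderiv_right (m := 1) (by norm_num)).differentiableAt (by simp)
  set D := fderiv ℝ (fderiv ℝ μ) (p, p) with hD
  have h1 : HasFDerivAt (fun u : E => fderiv ℝ μ (u, p))
      (D ∘L (ContinuousLinearMap.inl ℝ E E)) p := by
    have := (hd.hasFDerivAt).comp p (f := fun u : E => (u, p)) (hasFDerivAt_prodMk_left p p)
    exact this
  have h2 : HasFDerivAt (fun u : E => fderiv ℝ μ (p, u))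
      (D ∘L (ContinuousLinearMap.inr ℝ E E)) p := by
    have := (hd.hasFDerivAt).comp p (f := fun u : E => (p, u)) (hasFDerivAt_prodMk_right p p)
    exact this
  have hL : ∀ Z W : E, fderiv ℝ (fun u : E => fderiv ℝ μ (u, p) (0, Z)) p W = D (W, 0) (0, Z) := by
    intro Z W
    have := h1.clm_apply (hasFDerivAt_const ((0 : E), Z) p)
    rw [this.fderiv]
    simp
  have hR : HasFDerivAt (fun u : E => fderiv ℝ μ (p, u) (A u Y, 0))
      (((fderiv ℝ μ (p, p)) ∘L (ContinuousLinearMap.inl ℝ E E) ∘L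
        ((ContinuousLinearMap.apply ℝ E Y) ∘L fderiv ℝ A p)) +
        (D ∘L (ContinuousLinearMap.inr ℝ E E)).flip (A p Y, 0)) p := by
    have h3 : HasFDerivAt (fun u => ((A u Y, 0) : E × E))
        ((ContinuousLinearMap.inl ℝ E E) ∘L ((ContinuousLinearMap.apply ℝ E Y) ∘L fderiv ℝ A p))
        p := by
      have h4 : HasFDerivAt (fun u => A u Y)
          ((ContinuousLinearMap.apply ℝ E Y) ∘L fderiv ℝ A p) p :=
        (ContinuousLinearMap.apply ℝ E Y).hasFDerivAt.comp p hA.hasFDerivAt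
      exact (ContinuousLinearMap.inl ℝ E E).hasFDerivAt.comp p h4
    exact h2.clm_apply h3
  -- Differentiating `h` at `p` in the direction `X` gives `A'(X) Y + D((0, X), (Y, 0)) = D((X, 0),
  -- (0, Y))`. The symmetry of `D` turns this into the formula for the bracket.
  have hEq := (EventuallyEq.fderiv_eq (𝕜 := ℝ) h)
  have hEqX := congrArg (fun T : E →L[ℝ] E => T X) hEq
  simp only [hL, hR.fderiv] at hEqX
  simp only [add_apply, ContinuousLinearMap.comp_apply,
    ContinuousLinearMap.inl_apply, ContinuousLinearMap.flip_apply, ContinuousLinearMap.inr_apply,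
    ContinuousLinearMap.apply_apply, hl, hAp, ContinuousLinearMap.id_apply] at hEqX
  rw [lieBracket, hL, hL]
  simp only [hr]
  rw [hsymm.eq (Y, 0) (0, X), ← hEqX]
  simp [hD]

end FlagManifold
end

/-! ### The adjoint representation and the bracket in the chart at `1`. -/

noncomputable section

namespace FlagManifold

open Set Filter Topology VectorField

variable {n : ℕ} {G : Type*} [TopologicalSpace G] [ChartedSpace (EuclideanSpace ℝ (Fin n)) G]
  [Group G] [LieGroup (𝓡 n) ∞ G]

lemma mdifferentiable_mul_left (g : G) : MDifferentiable (𝓡 n) (𝓡 n) (fun x : G => g * x) :=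
  (contMDiff_mul_left (I := 𝓡 n) (n := ∞)).mdifferentiable (by simp)

lemma mdifferentiable_mul_right (g : G) : MDifferentiable (𝓡 n) (𝓡 n) (fun x : G => x * g) :=
  (contMDiff_mul_right (I := 𝓡 n) (n := ∞)).mdifferentiable (by simp)

lemma contMDiff_conj (g : G) : ContMDiff (𝓡 n) (𝓡 n) ∞ (fun x : G => g * x * g⁻¹) :=
  (contMDiff_mul_right (I := 𝓡 n) (n := ∞) (a := g⁻¹)).comp (contMDiff_mul_left (a := g))

lemma mdifferentiable_conj (g : G) : MDifferentiable (𝓡 n) (𝓡 n) (fun x : G => g * x * g⁻¹) :=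
  (contMDiff_conj g).mdifferentiable (by simp)

variable (n) in
/-- `Ad a` as an endomorphism of the model space. -/
def AdE (a : G) : EuclideanSpace ℝ (Fin n) →L[ℝ] EuclideanSpace ℝ (Fin n) := Ad n a

lemma hasMFDerivAt_conj (g : G) :
    HasMFDerivAt (𝓡 n) (𝓡 n) (fun x : G => g * x * g⁻¹) 1 (AdE n g) :=
  (mdifferentiable_conj g 1).hasMFDerivAt

lemma AdE_one : AdE n (1 : G) = ContinuousLinearMap.id ℝ _ := by
  have h := hasMFDerivAt_conj (n := n) (1 : G)
  have h2 : HasMFDerivAt (𝓡 n) (𝓡 n) (fun x : G => 1 * x * 1⁻¹) 1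
      (ContinuousLinearMap.id ℝ (EuclideanSpace ℝ (Fin n))) := by
    have e : (fun x : G => 1 * x * 1⁻¹) = id := by ext x; simp
    rw [e]
    exact hasMFDerivAt_id (I := 𝓡 n) (1 : G)
  exact hasMFDerivAt_unique h h2

lemma AdE_mul (a b : G) : AdE n (a * b) = AdE n a ∘L AdE n b := by
  have h := hasMFDerivAt_conj (n := n) (a * b)
  have hb := hasMFDerivAt_conj (n := n) b
  have ha : HasMFDerivAt (𝓡 n) (𝓡 n) (fun x : G => a * x * a⁻¹) (b * 1 * b⁻¹) (AdE n a) := by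
    have := hasMFDerivAt_conj (n := n) a
    rwa [show (b * 1 * b⁻¹ : G) = 1 by simp]
  have h2 := ha.comp (1 : G) hb
  have h3 : ((fun x : G => a * x * a⁻¹) ∘ fun x : G => b * x * b⁻¹) =
      fun x : G => a * b * x * (a * b)⁻¹ := by
    ext x; simp [mul_assoc]
  rw [h3] at h2
  exact hasMFDerivAt_unique h h2

/-- `u ↦ Ad u` is smooth. -/
lemma contMDiff_AdE : ContMDiff (𝓡 n) 𝓘(ℝ, EuclideanSpace ℝ (Fin n) →L[ℝ] EuclideanSpace ℝ (Fin n))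
    1 (AdE n : G → _) := by
  intro g
  have h : ContMDiffAt ((𝓡 n).prod (𝓡 n)) (𝓡 n) ∞
      (Function.uncurry (fun (a x : G) => a * x * a⁻¹)) (g, 1) := by
    have : ContMDiff ((𝓡 n).prod (𝓡 n)) (𝓡 n) ∞
      (Function.uncurry (fun (a x : G) => a * x * a⁻¹)) :=
      (contMDiff_fst.mul contMDiff_snd).mul (contMDiff_fst.inv)
    exact this _
  have h2 := ContMDiffAt.mfderiv (m := 1) (fun (a x : G) => a * x * a⁻¹) (fun _ => (1 : G)) h
    contMDiffAt_const (by norm_cast)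
  refine h2.congr_of_eventuallyEq (Eventually.of_forall fun a => ?_)
  -- Both base points, `1` and `a * 1 * a⁻¹`, equal `1` for every `a`, so the coordinate changes are
  -- trivial and the smooth family is `AdE` itself.
  have key := inTangentCoordinates_eq (I := 𝓡 n) (I' := 𝓡 n) (fun _ : G => (1 : G))
    (fun x : G => x * 1 * x⁻¹) (fun x => AdE n x) (x₀ := g) (x := a) (by simp) (by simp)
  refine Eq.trans ?_ key.symm
  ext1 v
  simp only [mul_one, mul_inv_cancel, ContinuousLinearMap.comp_apply]
  rw [(tangentBundleCore (𝓡 n) G).coordChange_self _ _ (by simp),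
    (tangentBundleCore (𝓡 n) G).coordChange_self _ _ (by simp)]

/-- Expression in the chart at `1` of the derivative at `1` of a map `G → G`. -/
lemma hasFDerivAt_chart_comp {F : G → G}
    {F' Φ' : EuclideanSpace ℝ (Fin n) →L[ℝ] EuclideanSpace ℝ (Fin n)}
    (hF : HasMFDerivAt (𝓡 n) (𝓡 n) F 1 F')
    (hΦ : HasMFDerivAt (𝓡 n) 𝓘(ℝ, EuclideanSpace ℝ (Fin n)) (extChartAt (𝓡 n) (1 : G)) (F 1) Φ') :
    HasFDerivAt (fun v => extChartAt (𝓡 n) (1 : G) (F ((extChartAt (𝓡 n) (1 : G)).symm v)))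
      (Φ' ∘L F') (extChartAt (𝓡 n) (1 : G) 1) := by
  have h0 : HasMFDerivAt 𝓘(ℝ, EuclideanSpace ℝ (Fin n)) (𝓡 n) (extChartAt (𝓡 n) (1 : G)).symm
      (extChartAt (𝓡 n) (1 : G) 1) (ContinuousLinearMap.id ℝ (EuclideanSpace ℝ (Fin n))) := by
    have h1 := (mdifferentiableWithinAt_extChartAt_symm (I := 𝓡 n)
      (mem_extChartAt_target (I := 𝓡 n) (1 : G))).hasMFDerivWithinAt
    rw [mfderivWithin_range_extChartAt_symm] at h1
    simp only [modelWithCornersSelf_coe, range_id] at h1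
    exact hasMFDerivWithinAt_univ.1 h1
  have h1 : HasMFDerivAt (𝓡 n) (𝓡 n) F
    ((extChartAt (𝓡 n) (1 : G)).symm (extChartAt (𝓡 n) (1 : G) 1)) F' := by
    rwa [extChartAt_to_inv]
  have h2 := h1.comp _ h0
  have h3 : HasMFDerivAt (𝓡 n) 𝓘(ℝ, EuclideanSpace ℝ (Fin n)) (extChartAt (𝓡 n) (1 : G))
      ((F ∘ (extChartAt (𝓡 n) (1 : G)).symm) (extChartAt (𝓡 n) (1 : G) 1)) Φ' := by
    have e : (F ∘ (extChartAt (𝓡 n) (1 : G)).symm) (extChartAt (𝓡 n) (1 : G) 1) = F 1 := by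
      simp
    rwa [e]
  have h4 := h3.comp _ h2
  exact hasMFDerivAt_iff_hasFDerivAt.1 h4

variable (n G) in
/-- The multiplication of `G` read in the chart at `1`. -/
def chartMul (p : EuclideanSpace ℝ (Fin n) × EuclideanSpace ℝ (Fin n)) : EuclideanSpace ℝ (Fin n) :=
  extChartAt (𝓡 n) (1 : G)
    ((extChartAt (𝓡 n) (1 : G)).symm p.1 * (extChartAt (𝓡 n) (1 : G)).symm p.2)

lemma contMDiffAt_extChartAt_symm_one : ContMDiffAt 𝓘(ℝ, EuclideanSpace ℝ (Fin n)) (𝓡 n) ∞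
    (extChartAt (𝓡 n) (1 : G)).symm (extChartAt (𝓡 n) (1 : G) 1) := by
  have : IsManifold (𝓡 n) ∞ G := LieGroup.toContMDiffMul.toIsManifold
  exact (contMDiffOn_extChartAt_symm (I := 𝓡 n) (n := ∞) (1 : G)).contMDiffAt
    (extChartAt_target_mem_nhds (I := 𝓡 n) (1 : G))

lemma contDiffAt_chartMul : ContDiffAt ℝ ∞ (chartMul n G)
    (extChartAt (𝓡 n) (1 : G) 1, extChartAt (𝓡 n) (1 : G) 1) := by
  have : IsManifold (𝓡 n) ∞ G := LieGroup.toContMDiffMul.toIsManifold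
  rw [← contMDiffAt_iff_contDiffAt]
  have h1 : ContMDiffAt 𝓘(ℝ, EuclideanSpace ℝ (Fin n) × EuclideanSpace ℝ (Fin n)) (𝓡 n) ∞
      (fun p : EuclideanSpace ℝ (Fin n) × EuclideanSpace ℝ (Fin n) =>
        (extChartAt (𝓡 n) (1 : G)).symm p.1)
      (extChartAt (𝓡 n) (1 : G) 1, extChartAt (𝓡 n) (1 : G) 1) :=
    contMDiffAt_extChartAt_symm_one.comp (x := (extChartAt (𝓡 n) (1 : G) 1,
      extChartAt (𝓡 n) (1 : G) 1)) (contDiff_fst.contMDiff.contMDiffAt)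
  have h2 : ContMDiffAt 𝓘(ℝ, EuclideanSpace ℝ (Fin n) × EuclideanSpace ℝ (Fin n)) (𝓡 n) ∞
      (fun p : EuclideanSpace ℝ (Fin n) × EuclideanSpace ℝ (Fin n) =>
        (extChartAt (𝓡 n) (1 : G)).symm p.2)
      (extChartAt (𝓡 n) (1 : G) 1, extChartAt (𝓡 n) (1 : G) 1) :=
    contMDiffAt_extChartAt_symm_one.comp (x := (extChartAt (𝓡 n) (1 : G) 1,
      extChartAt (𝓡 n) (1 : G) 1)) (contDiff_snd.contMDiff.contMDiffAt)
  refine ContMDiffAt.comp (I' := 𝓡 n) _ ?_ (h1.mul h2)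
  simp only [extChartAt_to_inv, mul_one]
  exact contMDiffAt_extChartAt

lemma hasFDerivAt_chartMul_left {u v : EuclideanSpace ℝ (Fin n)}
    (h : DifferentiableAt ℝ (chartMul n G) (u, v)) :
    HasFDerivAt (fun w => chartMul n G (u, w))
      (fderiv ℝ (chartMul n G) (u, v) ∘L ContinuousLinearMap.inr ℝ _ _) v :=
  HasFDerivAt.comp v (f := fun w => (u, w)) h.hasFDerivAt (hasFDerivAt_prodMk_right u v)

lemma hasFDerivAt_chartMul_right {u v : EuclideanSpace ℝ (Fin n)}
    (h : DifferentiableAt ℝ (chartMul n G) (u, v)) :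
    HasFDerivAt (fun w => chartMul n G (w, v))
      (fderiv ℝ (chartMul n G) (u, v) ∘L ContinuousLinearMap.inl ℝ _ _) u :=
  HasFDerivAt.comp u (f := fun w => (w, v)) h.hasFDerivAt (hasFDerivAt_prodMk_left u v)

lemma fderiv_chartMul_one_left (Z : EuclideanSpace ℝ (Fin n)) :
    fderiv ℝ (chartMul n G) (extChartAt (𝓡 n) (1 : G) 1, extChartAt (𝓡 n) (1 : G) 1) (0, Z) = Z := by
  have h := hasFDerivAt_chartMul_left (contDiffAt_chartMul (n := n) (G := G).differentiableAt
    (by simp))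
  have h2 : HasFDerivAt (fun w => chartMul n G (extChartAt (𝓡 n) (1 : G) 1, w))
      (ContinuousLinearMap.id ℝ _) (extChartAt (𝓡 n) (1 : G) 1) := by
    refine (hasFDerivAt_id _).congr_of_eventuallyEq ?_
    filter_upwards [extChartAt_target_mem_nhds (I := 𝓡 n) (1 : G)] with w hw
    simp only [chartMul, extChartAt_to_inv, one_mul, id]
    exact (extChartAt (𝓡 n) (1 : G)).right_inv hw
  exact congrArg (fun T => T Z) (h.unique h2)

lemma fderiv_chartMul_one_right (Z : EuclideanSpace ℝ (Fin n)) :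
    fderiv ℝ (chartMul n G) (extChartAt (𝓡 n) (1 : G) 1, extChartAt (𝓡 n) (1 : G) 1) (Z, 0) = Z := by
  have h := hasFDerivAt_chartMul_right (contDiffAt_chartMul (n := n) (G := G).differentiableAt
    (by simp))
  have h2 : HasFDerivAt (fun w => chartMul n G (w, extChartAt (𝓡 n) (1 : G) 1))
      (ContinuousLinearMap.id ℝ _) (extChartAt (𝓡 n) (1 : G) 1) := by
    refine (hasFDerivAt_id _).congr_of_eventuallyEq ?_
    filter_upwards [extChartAt_target_mem_nhds (I := 𝓡 n) (1 : G)] with w hw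
    simp only [chartMul, extChartAt_to_inv, mul_one, id]
    exact (extChartAt (𝓡 n) (1 : G)).right_inv hw
  exact congrArg (fun T => T Z) (h.unique h2)

lemma eventually_differentiableAt_chartMul :
    ∀ᶠ p in 𝓝 (extChartAt (𝓡 n) (1 : G) 1, extChartAt (𝓡 n) (1 : G) 1),
      DifferentiableAt ℝ (chartMul n G) p :=
  ((contDiffAt_chartMul (n := n) (G := G).of_le (m := 1) (by norm_cast)).eventually
    (by simp)).mono fun _ h => h.differentiableAt (by simp)

lemma eventually_differentiableAt_chartMul_left : ∀ᶠ u in 𝓝 (extChartAt (𝓡 n) (1 : G) 1),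
      DifferentiableAt ℝ (chartMul n G) (u, extChartAt (𝓡 n) (1 : G) 1) :=
  (Continuous.tendsto (by fun_prop) _).eventually eventually_differentiableAt_chartMul

lemma eventually_differentiableAt_chartMul_right : ∀ᶠ u in 𝓝 (extChartAt (𝓡 n) (1 : G) 1),
      DifferentiableAt ℝ (chartMul n G) (extChartAt (𝓡 n) (1 : G) 1, u) :=
  (Continuous.tendsto (by fun_prop) _).eventually eventually_differentiableAt_chartMul

/-- The left invariant vector fields in the chart at `1`. -/
lemma eventually_mpullbackWithin_mulInvariantVectorField (Y : GroupLieAlgebra (𝓡 n) G) :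
    ∀ᶠ u in 𝓝 (extChartAt (𝓡 n) (1 : G) 1),
      mpullbackWithin 𝓘(ℝ, EuclideanSpace ℝ (Fin n)) (𝓡 n) (extChartAt (𝓡 n) (1 : G)).symm
        (mulInvariantVectorField Y) (range (𝓡 n)) u =
      fderiv ℝ (chartMul n G) (u, extChartAt (𝓡 n) (1 : G) 1) (0, Y) := by
  filter_upwards [extChartAt_target_mem_nhds (I := 𝓡 n) (1 : G),
    eventually_differentiableAt_chartMul_left (G := G)] with u hu hd
  set g := (extChartAt (𝓡 n) (1 : G)).symm u with hg
  have hgs : g ∈ (chartAt (EuclideanSpace ℝ (Fin n)) (1 : G)).source := by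
    rw [← extChartAt_source (𝓡 n)]; exact (extChartAt (𝓡 n) (1 : G)).map_target hu
  -- Pulling back along the inverse chart is applying the differential of the chart.
  have hinv : (mfderivWithin 𝓘(ℝ, EuclideanSpace ℝ (Fin n)) (𝓡 n)
      (extChartAt (𝓡 n) (1 : G)).symm (range (𝓡 n)) u).inverse =
      mfderiv (𝓡 n) 𝓘(ℝ, EuclideanSpace ℝ (Fin n)) (extChartAt (𝓡 n) (1 : G)) g :=
    ContinuousLinearMap.inverse_eq
      (mfderivWithin_extChartAt_symm_comp_mfderiv_extChartAt hu)
      (mfderiv_extChartAt_comp_mfderivWithin_extChartAt_symm hu)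
  have hΦ := (mdifferentiableAt_extChartAt (I := 𝓡 n) hgs).hasMFDerivAt
  have hΦ' : HasMFDerivAt (𝓡 n) 𝓘(ℝ, EuclideanSpace ℝ (Fin n)) (extChartAt (𝓡 n) (1 : G)) (g * 1)
      (mfderiv (𝓡 n) 𝓘(ℝ, EuclideanSpace ℝ (Fin n)) (extChartAt (𝓡 n) (1 : G)) g) := by
    rwa [mul_one]
  have h1 := hasFDerivAt_chart_comp ((mdifferentiable_mul_left g 1).hasMFDerivAt) hΦ'
  have h2 := h1.unique (hasFDerivAt_chartMul_left hd)
  have h3 := congrArg (fun T => T Y) h2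
  rw [mpullbackWithin_apply, hinv]
  exact h3

/-- `L_Y(g) = dR_g (Ad g Y)` in the chart at `1`. -/
lemma eventually_fderiv_chartMul_AdE (Y : EuclideanSpace ℝ (Fin n)) :
    ∀ᶠ u in 𝓝 (extChartAt (𝓡 n) (1 : G) 1),
      fderiv ℝ (chartMul n G) (extChartAt (𝓡 n) (1 : G) 1, u)
        (AdE n ((extChartAt (𝓡 n) (1 : G)).symm u) Y, 0) =
      fderiv ℝ (chartMul n G) (u, extChartAt (𝓡 n) (1 : G) 1) (0, Y) := by
  filter_upwards [extChartAt_target_mem_nhds (I := 𝓡 n) (1 : G),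
    eventually_differentiableAt_chartMul_left (G := G),
    eventually_differentiableAt_chartMul_right (G := G)] with u hu hd hd'
  set g := (extChartAt (𝓡 n) (1 : G)).symm u with hg
  have hgs : g ∈ (chartAt (EuclideanSpace ℝ (Fin n)) (1 : G)).source := by
    rw [← extChartAt_source (𝓡 n)]; exact (extChartAt (𝓡 n) (1 : G)).map_target hu
  have hΦ := (mdifferentiableAt_extChartAt (I := 𝓡 n) hgs).hasMFDerivAt
  have hΦ' : HasMFDerivAt (𝓡 n) 𝓘(ℝ, EuclideanSpace ℝ (Fin n)) (extChartAt (𝓡 n) (1 : G)) (g * 1)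
      (mfderiv (𝓡 n) 𝓘(ℝ, EuclideanSpace ℝ (Fin n)) (extChartAt (𝓡 n) (1 : G)) g) := by
    rwa [mul_one]
  have hΦ'' : HasMFDerivAt (𝓡 n) 𝓘(ℝ, EuclideanSpace ℝ (Fin n)) (extChartAt (𝓡 n) (1 : G)) (1 * g)
      (mfderiv (𝓡 n) 𝓘(ℝ, EuclideanSpace ℝ (Fin n)) (extChartAt (𝓡 n) (1 : G)) g) := by
    rwa [one_mul]
  have hl := (mdifferentiable_mul_left (n := n) g 1).hasMFDerivAt
  have hr := (mdifferentiable_mul_right (n := n) g 1).hasMFDerivAt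
  have h1 := (hasFDerivAt_chart_comp hl hΦ').unique (hasFDerivAt_chartMul_left hd)
  have h2 := (hasFDerivAt_chart_comp hr hΦ'').unique (hasFDerivAt_chartMul_right hd')
  have h1Y := congrArg (fun T => T Y) h1
  have h2Y := congrArg (fun T => T (AdE n g Y)) h2
  have hr' : HasMFDerivAt (𝓡 n) (𝓡 n) (fun x : G => x * g) (g * 1 * g⁻¹)
      (mfderiv (𝓡 n) (𝓡 n) (fun x : G => x * g) 1) := by
    rwa [show g * 1 * g⁻¹ = 1 by simp]
  -- Left translation by `g` is conjugation by `g` followed by right translation by `g`; this is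
  -- differentiated at `1`.
  have hc := hr'.comp 1 (hasMFDerivAt_conj g)
  have e : ((fun x : G => x * g) ∘ fun x => g * x * g⁻¹) = fun x => g * x := by
    ext x; simp
  rw [e] at hc
  have hlr := congrArg (fun T => T Y) (hasMFDerivAt_unique hl hc)
  refine h2Y.symm.trans (Eq.trans ?_ h1Y)
  exact congrArg (mfderiv (𝓡 n) 𝓘(ℝ, EuclideanSpace ℝ (Fin n)) (extChartAt (𝓡 n) (1 : G)) g) hlr.symm

/-- The bracket on `𝔤` is the value at `1` of the bracket of left invariant fields, computed in the
chart at `1`, whose differential at `1` is the identity. -/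
lemma bracket_eq_lieBracket_chart (X Y : GroupLieAlgebra (𝓡 n) G) :
    ⁅X, Y⁆ = lieBracket ℝ
      (fun u => fderiv ℝ (chartMul n G) (u, extChartAt (𝓡 n) (1 : G) 1) (0, X))
      (fun u => fderiv ℝ (chartMul n G) (u, extChartAt (𝓡 n) (1 : G) 1) (0, Y))
      (extChartAt (𝓡 n) (1 : G) 1) := by
  rw [GroupLieAlgebra.bracket_def, ← mlieBracketWithin_univ, mlieBracketWithin_apply]
  rw [mfderiv_extChartAt_self]
  have hid : ∀ v, (ContinuousLinearMap.id ℝ (TangentSpace (𝓡 n) (1 : G))).inverse v = v :=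
    fun v => congrArg (fun T : TangentSpace (𝓡 n) (1 : G) →L[ℝ] TangentSpace (𝓡 n) (1 : G) => T v)
      ContinuousLinearMap.inverse_id
  refine (hid _).trans ?_
  refine Eq.trans (b := lieBracketWithin ℝ _ _ univ (extChartAt (𝓡 n) (1 : G) 1)) ?_
    ((congrFun lieBracketWithin_univ _).trans (EventuallyEq.lieBracket_vectorField_eq
      (eventually_mpullbackWithin_mulInvariantVectorField X)
      (eventually_mpullbackWithin_mulInvariantVectorField Y)))
  simp

/-- The derivative of `u ↦ Ad u` at `1` is `ad`. -/
lemma exists_hasMFDerivAt_AdE_one :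
    ∃ A' : EuclideanSpace ℝ (Fin n) →L[ℝ]
        (EuclideanSpace ℝ (Fin n) →L[ℝ] EuclideanSpace ℝ (Fin n)),
      HasMFDerivAt (𝓡 n) 𝓘(ℝ, EuclideanSpace ℝ (Fin n) →L[ℝ] EuclideanSpace ℝ (Fin n))
        (AdE n : G → _) 1 A' ∧
      ∀ X Y : GroupLieAlgebra (𝓡 n) G, A' X Y = ⁅X, Y⁆ := by
  have hd : MDifferentiableAt (𝓡 n)
      𝓘(ℝ, EuclideanSpace ℝ (Fin n) →L[ℝ] EuclideanSpace ℝ (Fin n)) (AdE n : G → _) 1 :=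
    contMDiff_AdE.mdifferentiable (by simp) 1
  have hs : MDifferentiableAt 𝓘(ℝ, EuclideanSpace ℝ (Fin n)) (𝓡 n)
      (extChartAt (𝓡 n) (1 : G)).symm (extChartAt (𝓡 n) (1 : G) 1) :=
    contMDiffAt_extChartAt_symm_one.mdifferentiableAt (by simp)
  obtain ⟨A', h1⟩ : ∃ A' : EuclideanSpace ℝ (Fin n) →L[ℝ]
      (EuclideanSpace ℝ (Fin n) →L[ℝ] EuclideanSpace ℝ (Fin n)),
      HasMFDerivAt (𝓡 n) 𝓘(ℝ, EuclideanSpace ℝ (Fin n) →L[ℝ] EuclideanSpace ℝ (Fin n))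
        (AdE n : G → _) 1 A' := ⟨_, hd.hasMFDerivAt⟩
  refine ⟨A', h1, fun X Y => ?_⟩
  set e := extChartAt (𝓡 n) (1 : G) 1 with he
  have hA : HasMFDerivAt 𝓘(ℝ, EuclideanSpace ℝ (Fin n))
      𝓘(ℝ, EuclideanSpace ℝ (Fin n) →L[ℝ] EuclideanSpace ℝ (Fin n))
      (fun u => AdE n ((extChartAt (𝓡 n) (1 : G)).symm u)) e A' := by
    have h0 : HasMFDerivAt 𝓘(ℝ, EuclideanSpace ℝ (Fin n)) (𝓡 n) (extChartAt (𝓡 n) (1 : G)).symm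
        e (ContinuousLinearMap.id ℝ (EuclideanSpace ℝ (Fin n))) := by
      have h1 := (mdifferentiableWithinAt_extChartAt_symm (I := 𝓡 n)
        (mem_extChartAt_target (I := 𝓡 n) (1 : G))).hasMFDerivWithinAt
      rw [mfderivWithin_range_extChartAt_symm] at h1
      simp only [modelWithCornersSelf_coe, range_id] at h1
      exact hasMFDerivWithinAt_univ.1 h1
    have h2 : HasMFDerivAt (𝓡 n) 𝓘(ℝ, EuclideanSpace ℝ (Fin n) →L[ℝ] EuclideanSpace ℝ (Fin n))
        (AdE n : G → _) ((extChartAt (𝓡 n) (1 : G)).symm e) A' := by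
      rwa [he, extChartAt_to_inv]
    exact h2.comp _ h0
  have hA' : HasFDerivAt (fun u => AdE n ((extChartAt (𝓡 n) (1 : G)).symm u)) A' e :=
    hasMFDerivAt_iff_hasFDerivAt.1 hA
  have key := fderiv_localAd_eq_lieBracket (μ := chartMul n G) (p := e)
    (A := fun u => AdE n ((extChartAt (𝓡 n) (1 : G)).symm u))
    (contDiffAt_chartMul.of_le (by norm_cast)) hA'.differentiableAt
    (by rw [he, extChartAt_to_inv, AdE_one]) fderiv_chartMul_one_right fderiv_chartMul_one_left
    X Y (eventually_fderiv_chartMul_AdE Y)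
  rw [bracket_eq_lieBracket_chart, ← key, hA'.fderiv]

end FlagManifold
end

/-! ### One-parameter groups and the derivative of `Ad` along them. -/

noncomputable section

namespace FlagManifold

open Set Filter Topology VectorField

variable {n : ℕ} {G : Type*} [TopologicalSpace G] [ChartedSpace (EuclideanSpace ℝ (Fin n)) G]
  [Group G] [LieGroup (𝓡 n) ∞ G]

/-- A homomorphism of Lie groups maps left invariant vector fields to left invariant ones. -/
lemma mfderiv_mulInvariantVectorField {c : G →* G} (hc : MDifferentiable (𝓡 n) (𝓡 n) c)
    {C : EuclideanSpace ℝ (Fin n) →L[ℝ] EuclideanSpace ℝ (Fin n)}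
    (hC : HasMFDerivAt (𝓡 n) (𝓡 n) c 1 C) (X : GroupLieAlgebra (𝓡 n) G) (g : G) :
    mfderiv (𝓡 n) (𝓡 n) c g (mulInvariantVectorField X g) =
      mulInvariantVectorField (I := 𝓡 n) (G := G) (C X) (c g) := by
  have hl := (mdifferentiable_mul_left (n := n) g 1).hasMFDerivAt
  have hl' := (mdifferentiable_mul_left (n := n) (c g) 1).hasMFDerivAt
  have h1 : HasMFDerivAt (𝓡 n) (𝓡 n) c (g * 1) (mfderiv (𝓡 n) (𝓡 n) c g) := by
    rw [mul_one]; exact (hc g).hasMFDerivAt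
  have h2 : HasMFDerivAt (𝓡 n) (𝓡 n) (fun x => c g * x) (c 1)
      (mfderiv (𝓡 n) (𝓡 n) (fun x => c g * x) 1) := by
    rw [map_one]; exact hl'
  have h3 := h1.comp 1 hl
  have h4 := h2.comp 1 hC
  have e : (c ∘ fun x => g * x) = (fun x => c g * x) ∘ c := by ext x; simp
  rw [e] at h3
  exact congrArg (fun T : EuclideanSpace ℝ (Fin n) →L[ℝ] EuclideanSpace ℝ (Fin n) => T X)
    (hasMFDerivAt_unique h3 h4)

lemma isMIntegralCurve_comp_hom {c : G →* G} (hc : MDifferentiable (𝓡 n) (𝓡 n) c)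
    {C : EuclideanSpace ℝ (Fin n) →L[ℝ] EuclideanSpace ℝ (Fin n)}
    (hC : HasMFDerivAt (𝓡 n) (𝓡 n) c 1 C) {X : GroupLieAlgebra (𝓡 n) G} {γ : ℝ → G}
    (hγ : IsMIntegralCurve (I := 𝓡 n) γ (mulInvariantVectorField X)) :
    IsMIntegralCurve (I := 𝓡 n) (c ∘ γ)
      (mulInvariantVectorField (I := 𝓡 n) (G := G) (C X)) := by
  intro t
  have h := (hc (γ t)).hasMFDerivAt.comp t (hγ t)
  refine h.congr_mfderiv ?_
  ext
  exact (ContinuousLinearMap.map_smul _ _ _).trans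
    (congrArg _ (mfderiv_mulInvariantVectorField hc hC X (γ t)))

/-- A one-parameter group is the integral curve of a left invariant vector field. -/
lemma isMIntegralCurve_of_add {η : ℝ → G} (hadd : ∀ s t, η (s + t) = η s * η t)
    {D : ℝ →L[ℝ] EuclideanSpace ℝ (Fin n)} (hη : HasMFDerivAt 𝓘(ℝ, ℝ) (𝓡 n) η 0 D) :
    IsMIntegralCurve (I := 𝓡 n) η (mulInvariantVectorField (I := 𝓡 n) (G := G) (D 1)) := by
  have h0 : η 0 = 1 := by simpa using hadd 0 0
  intro t
  have h1 : HasMFDerivAt 𝓘(ℝ, ℝ) 𝓘(ℝ, ℝ) (fun s : ℝ => s - t) t (ContinuousLinearMap.id ℝ ℝ) :=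
    hasMFDerivAt_iff_hasFDerivAt.2 ((hasFDerivAt_id t).sub_const t)
  have h2 : HasMFDerivAt 𝓘(ℝ, ℝ) (𝓡 n) η (t - t) D := by rwa [sub_self]
  have hl : HasMFDerivAt (𝓡 n) (𝓡 n) (fun x => η t * x) (η (t - t))
      (mfderiv (𝓡 n) (𝓡 n) (fun x => η t * x) 1) := by
    rw [sub_self, h0]; exact (mdifferentiable_mul_left (n := n) (η t) 1).hasMFDerivAt
  have h3 := hl.comp t (h2.comp (f := fun s : ℝ => s - t) t h1)
  -- The identity `η s = η t * η (s - t)` transports the derivative at `0` to `t`.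
  have e : ((fun x => η t * x) ∘ η ∘ fun s => s - t) = η := by
    ext s; simp [← hadd]
  rw [e] at h3
  refine h3.congr_mfderiv ?_
  ext
  exact (one_smul ℝ _).symm

variable [T2Space G]

instance : IsManifold (𝓡 n) 1 G := by
  have : IsManifold (𝓡 n) ∞ G := LieGroup.toContMDiffMul.toIsManifold
  exact IsManifold.of_le (n := ∞) (by norm_cast)

lemma contMDiff_one_mulInvariantVectorField (X : GroupLieAlgebra (𝓡 n) G) :
    ContMDiff (𝓡 n) (𝓡 n).tangent 1
      (fun g : G => (mulInvariantVectorField X g : TangentBundle (𝓡 n) G)) :=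
  (contMDiff_mulInvariantVectorField X).of_le (by
    rw [minSmoothness_of_isRCLikeNormedField]; norm_num)

lemma isMIntegralCurve_mulInvariant_unique {X : GroupLieAlgebra (𝓡 n) G} {γ γ' : ℝ → G}
    (hγ : IsMIntegralCurve (I := 𝓡 n) γ (mulInvariantVectorField X))
    (hγ' : IsMIntegralCurve (I := 𝓡 n) γ' (mulInvariantVectorField X)) (h : γ 0 = γ' 0) :
    γ = γ' :=
  isMIntegralCurve_Ioo_eq_of_contMDiff_boundaryless (t₀ := 0)
    (contMDiff_one_mulInvariantVectorField X) hγ hγ' h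

lemma mfderiv_mul_left_mulInvariantVectorField (X : GroupLieAlgebra (𝓡 n) G) (g x : G) :
    mfderiv (𝓡 n) (𝓡 n) (fun y => g * y) x (mulInvariantVectorField X x) =
      mulInvariantVectorField X (g * x) := by
  have hl := (mdifferentiable_mul_left (n := n) x 1).hasMFDerivAt
  have hl' := (mdifferentiable_mul_left (n := n) (g * x) 1).hasMFDerivAt
  have h1 : HasMFDerivAt (𝓡 n) (𝓡 n) (fun y => g * y) (x * 1)
      (mfderiv (𝓡 n) (𝓡 n) (fun y => g * y) x) := by
    rw [mul_one]; exact (mdifferentiable_mul_left (n := n) g x).hasMFDerivAt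
  have h3 := h1.comp 1 hl
  have e : ((fun y => g * y) ∘ fun y => x * y) = (fun y => g * x * y) := by
    ext y; simp [mul_assoc]
  rw [e] at h3
  exact congrArg (fun T : EuclideanSpace ℝ (Fin n) →L[ℝ] EuclideanSpace ℝ (Fin n) => T X)
    (hasMFDerivAt_unique h3 hl')

/-- Left invariant fields are complete: left translates of one local integral curve through `1`
start at every point and live for the same time `ε`. -/
lemma exists_isMIntegralCurve_mulInvariant (X : GroupLieAlgebra (𝓡 n) G) :
    ∃ γ : ℝ → G, γ 0 = 1 ∧ IsMIntegralCurve (I := 𝓡 n) γ (mulInvariantVectorField X) := by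
  have hX := contMDiff_one_mulInvariantVectorField X
  obtain ⟨γ, hγ0, hγ⟩ := exists_isMIntegralCurveAt_of_contMDiffAt_boundaryless (I := 𝓡 n) 0
    (hX.contMDiffAt (x := (1 : G)))
  obtain ⟨ε, hε, hγε⟩ := isMIntegralCurveAt_iff'.1 hγ
  refine exists_isMIntegralCurve_of_isMIntegralCurveOn hX hε (fun x => ?_) 1
  refine ⟨fun t => x * γ t, by simp [hγ0], ?_⟩
  rw [Real.ball_eq_Ioo, zero_sub, zero_add] at hγε
  intro t ht
  have h := (mdifferentiable_mul_left (n := n) x (γ t)).hasMFDerivAt.comp_hasMFDerivWithinAt t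
    (hγε t ht)
  refine h.congr_mfderiv ?_
  ext
  exact (ContinuousLinearMap.map_smul _ _ _).trans
    (congrArg _ (mfderiv_mul_left_mulInvariantVectorField X x (γ t)))

lemma mulInvariantVectorField_one (X : GroupLieAlgebra (𝓡 n) G) :
    mulInvariantVectorField X (1 : G) = X := by
  have h := (mdifferentiable_mul_left (n := n) (1 : G) 1).hasMFDerivAt
  have e : (fun x : G => 1 * x) = id := by ext x; simp
  have h2 : HasMFDerivAt (𝓡 n) (𝓡 n) (fun x : G => 1 * x) 1
      (ContinuousLinearMap.id ℝ (EuclideanSpace ℝ (Fin n))) := by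
    rw [e]; exact hasMFDerivAt_id (I := 𝓡 n) (1 : G)
  exact congrArg (fun T : EuclideanSpace ℝ (Fin n) →L[ℝ] EuclideanSpace ℝ (Fin n) => T X)
    (hasMFDerivAt_unique h h2)

lemma hasMFDerivAt_zero_of_isMIntegralCurve {γ : ℝ → G} {X : GroupLieAlgebra (𝓡 n) G}
    (h0 : γ 0 = 1) (hγ : IsMIntegralCurve (I := 𝓡 n) γ (mulInvariantVectorField X)) :
    HasMFDerivAt 𝓘(ℝ, ℝ) (𝓡 n) γ 0
      (ContinuousLinearMap.toSpanSingleton ℝ (show EuclideanSpace ℝ (Fin n) from X)) := by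
  refine (hγ 0).congr_mfderiv ?_
  ext
  refine congrArg (fun v : EuclideanSpace ℝ (Fin n) => (1 : ℝ) • v) ?_
  have : ∀ g : G, g = 1 →
      ((mulInvariantVectorField X g : TangentSpace (𝓡 n) g) : EuclideanSpace ℝ (Fin n)) = X := by
    rintro g rfl
    exact mulInvariantVectorField_one X
  exact this _ h0

/-- The derivative of `Ad` along a curve through `1`. -/
lemma hasDerivAt_AdE {γ : ℝ → G} {X : GroupLieAlgebra (𝓡 n) G} (h0 : γ 0 = 1)
    (hγ : IsMIntegralCurve (I := 𝓡 n) γ (mulInvariantVectorField X))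
    (Y : GroupLieAlgebra (𝓡 n) G) :
    HasDerivAt (F := EuclideanSpace ℝ (Fin n)) (fun t => AdE n (γ t) Y)
      (⁅X, Y⁆ : GroupLieAlgebra (𝓡 n) G) 0 := by
  obtain ⟨A', hA, hAX⟩ := exists_hasMFDerivAt_AdE_one (n := n) (G := G)
  have hA' : HasMFDerivAt (𝓡 n) 𝓘(ℝ, EuclideanSpace ℝ (Fin n) →L[ℝ] EuclideanSpace ℝ (Fin n))
        (AdE n : G → _) (γ 0) A' := by rwa [h0]
  have h1 := hasMFDerivAt_iff_hasFDerivAt.1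
    (hA'.comp (0 : ℝ) (hasMFDerivAt_zero_of_isMIntegralCurve h0 hγ))
  have h2 := ((ContinuousLinearMap.apply ℝ (EuclideanSpace ℝ (Fin n))
    (show EuclideanSpace ℝ (Fin n) from Y)).hasFDerivAt.comp (0 : ℝ) h1).hasDerivAt
  refine h2.congr_deriv ?_
  rw [← hAX]
  have e : (ContinuousLinearMap.toSpanSingleton ℝ (show EuclideanSpace ℝ (Fin n) from X)) 1 = X :=
    one_smul ℝ _
  exact congrArg (fun v => A' v Y) e

/-- The derivative of `Ad` along a curve through `1`, tested on a linear form. -/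
lemma hasDerivAt_apply_Ad {γ : ℝ → G} {X : GroupLieAlgebra (𝓡 n) G} (h0 : γ 0 = 1)
    (hγ : IsMIntegralCurve (I := 𝓡 n) γ (mulInvariantVectorField X))
    (Y : GroupLieAlgebra (𝓡 n) G) (l : Module.Dual ℝ (GroupLieAlgebra (𝓡 n) G)) :
    HasDerivAt (fun t => l (Ad n (γ t) Y)) (l ⁅X, Y⁆) 0 := by
  let l' : EuclideanSpace ℝ (Fin n) →ₗ[ℝ] ℝ := l
  exact (LinearMap.toContinuousLinearMap l').hasFDerivAt.comp_hasDerivAt (0 : ℝ)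
    (hasDerivAt_AdE h0 hγ Y)

/-- The derivative of `Ad` along a curve through `1`, in a bilinear form. -/
lemma hasDerivAt_bilin_Ad {γ : ℝ → G} {X : GroupLieAlgebra (𝓡 n) G} (h0 : γ 0 = 1)
    (hγ : IsMIntegralCurve (I := 𝓡 n) γ (mulInvariantVectorField X))
    (Y Z : GroupLieAlgebra (𝓡 n) G) (B : LinearMap.BilinForm ℝ (GroupLieAlgebra (𝓡 n) G)) :
    HasDerivAt (fun t => B (Ad n (γ t) Y) (Ad n (γ t) Z)) (B ⁅X, Y⁆ Z + B Y ⁅X, Z⁆) 0 := by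
  let B' : EuclideanSpace ℝ (Fin n) →ₗ[ℝ] EuclideanSpace ℝ (Fin n) →ₗ[ℝ] ℝ := B
  have h1 := (B'.toContinuousBilinearMap).hasFDerivAt.comp_hasDerivAt (0 : ℝ)
    (hasDerivAt_AdE h0 hγ Y)
  have h2 := h1.clm_apply (hasDerivAt_AdE h0 hγ Z)
  refine h2.congr_deriv ?_
  have e : ∀ W, AdE n (γ 0) W = W := by
    intro W; rw [h0, AdE_one]; rfl
  exact congr (congrArg (fun x y : ℝ => x + y) (congrArg (fun W => B ⁅X, Y⁆ W) (e Z)))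
    (congrArg (fun W => B W ⁅X, Z⁆) (e Y))

lemma Ad_one_apply (X : GroupLieAlgebra (𝓡 n) G) : Ad n (1 : G) X = X :=
  congrArg (fun T => T X) (AdE_one (n := n) (G := G))

lemma Ad_mul_apply (a b : G) (X : GroupLieAlgebra (𝓡 n) G) :
    Ad n (a * b) X = Ad n a (Ad n b X) :=
  congrArg (fun T => T X) (AdE_mul (n := n) a b)

lemma Ad_inv_apply_self (a : G) (X : GroupLieAlgebra (𝓡 n) G) : Ad n a⁻¹ (Ad n a X) = X := by
  rw [← Ad_mul_apply, inv_mul_cancel, Ad_one_apply]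

lemma Ad_apply_inv_self (a : G) (X : GroupLieAlgebra (𝓡 n) G) : Ad n a (Ad n a⁻¹ X) = X := by
  rw [← Ad_mul_apply, mul_inv_cancel, Ad_one_apply]

lemma continuous_bilin_Ad (B : LinearMap.BilinForm ℝ (GroupLieAlgebra (𝓡 n) G))
    (Y Z : GroupLieAlgebra (𝓡 n) G) :
    Continuous (fun a : G => B (Ad n a Y) (Ad n a Z)) := by
  let B' : EuclideanSpace ℝ (Fin n) →ₗ[ℝ] EuclideanSpace ℝ (Fin n) →ₗ[ℝ] ℝ := B
  have h : Continuous (AdE n : G → _) := contMDiff_AdE.continuous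
  have h1 : ∀ W : EuclideanSpace ℝ (Fin n), Continuous (fun a : G => AdE n a W) :=
    fun W => h.clm_apply continuous_const
  exact ((B'.toContinuousBilinearMap).continuous.comp (h1 Y)).clm_apply (h1 Z)

end FlagManifold
end

/-! ### An endomorphism of a connected Lie group with differential the identity at `1` is the
identity. -/

noncomputable section

namespace FlagManifold

open Set Filter Topology VectorField

/-- A map between manifolds with vanishing differential is locally constant. -/
lemma isLocallyConstant_of_hasMFDerivAt_zero {E : Type*} [NormedAddCommGroup E] [NormedSpace ℝ E]
    {M : Type*} [TopologicalSpace M] [ChartedSpace E M] [IsManifold 𝓘(ℝ, E) 1 M]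
    {h : M → M} (hh : ∀ x, HasMFDerivAt 𝓘(ℝ, E) 𝓘(ℝ, E) h x (0 : E →L[ℝ] E)) :
    IsLocallyConstant h := by
  rw [IsLocallyConstant.iff_eventually_eq]
  intro x
  set φ := extChartAt 𝓘(ℝ, E) x with hφ
  set ψ := extChartAt 𝓘(ℝ, E) (h x) with hψ
  have hcont : Continuous h := continuous_iff_continuousAt.2 fun y => (hh y).continuousAt
  have ht : φ.target ∩ φ.symm ⁻¹' (h ⁻¹' ψ.source) ∈ 𝓝 (φ x) := by
    refine inter_mem (extChartAt_target_mem_nhds (I := 𝓘(ℝ, E)) x) ?_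
    have : ContinuousAt φ.symm (φ x) := continuousAt_extChartAt_symm (I := 𝓘(ℝ, E)) x
    refine this.preimage_mem_nhds ?_
    rw [extChartAt_to_inv]
    exact hcont.continuousAt.preimage_mem_nhds (extChartAt_source_mem_nhds (I := 𝓘(ℝ, E)) (h x))
  -- On this ball `h` stays in the domain of the chart `ψ`, so the local expression of `h` is
  -- defined with zero derivative, hence is constant; injectivity of `ψ` then gives the claim for
  -- `h`.
  obtain ⟨r, hr, hball⟩ := Metric.mem_nhds_iff.1 ht
  have hder : ∀ v ∈ Metric.ball (φ x) r, HasFDerivAt (fun v => ψ (h (φ.symm v))) (0 : E →L[ℝ] E) v := by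
    intro v hv
    obtain ⟨hv1, hv2⟩ := hball hv
    have h1 := (mdifferentiableWithinAt_extChartAt_symm (I := 𝓘(ℝ, E)) hv1).hasMFDerivWithinAt
    simp only [modelWithCornersSelf_coe, range_id] at h1
    have h1' := hasMFDerivWithinAt_univ.1 h1
    have h2 := (hh (φ.symm v)).comp v h1'
    have h3 := (mdifferentiableAt_extChartAt (I := 𝓘(ℝ, E)) (x := h x) (y := h (φ.symm v))
      (by rw [← extChartAt_source 𝓘(ℝ, E)]; exact hv2)).hasMFDerivAt.comp v h2
    have h4 := hasMFDerivAt_iff_hasFDerivAt.1 h3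
    refine h4.congr_fderiv ?_
    ext w
    exact ContinuousLinearMap.map_zero _
  have hconst : ∀ v ∈ Metric.ball (φ x) r, ψ (h (φ.symm v)) = ψ (h x) := by
    intro v hv
    have := (convex_ball (φ x) r).is_const_of_fderivWithin_eq_zero (𝕜 := ℝ)
      (f := fun v => ψ (h (φ.symm v)))
      (fun w hw => (hder w hw).differentiableAt.differentiableWithinAt)
      (fun w hw => by
        rw [fderivWithin_of_isOpen Metric.isOpen_ball hw, (hder w hw).fderiv])
      hv (Metric.mem_ball_self hr)
    simpa [hφ] using this
  have hev : ∀ᶠ y in 𝓝 x, φ y ∈ Metric.ball (φ x) r :=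
    (continuousAt_extChartAt (I := 𝓘(ℝ, E)) x).preimage_mem_nhds (Metric.ball_mem_nhds _ hr)
  filter_upwards [hev, extChartAt_source_mem_nhds (I := 𝓘(ℝ, E)) x] with y hy hys
  have e1 := hconst _ hy
  have e2 := (hball hy).2
  rw [φ.left_inv hys] at e1
  simp only [mem_preimage, φ.left_inv hys] at e2
  exact ψ.injOn e2 (mem_extChartAt_source (h x)) e1

variable {n : ℕ} {G : Type*} [TopologicalSpace G] [ChartedSpace (EuclideanSpace ℝ (Fin n)) G]
  [Group G] [LieGroup (𝓡 n) ∞ G] [T2Space G]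

/-- Two homomorphisms of a connected Lie group with the same differential at `1` are equal:
the case of an automorphism with trivial differential. -/
lemma hom_eq_self_of_hasMFDerivAt_id [ConnectedSpace G] {c : G →* G}
    (hc : ContMDiff (𝓡 n) (𝓡 n) ∞ c)
    (h1 : HasMFDerivAt (𝓡 n) (𝓡 n) c 1 (ContinuousLinearMap.id ℝ (EuclideanSpace ℝ (Fin n))))
    (x : G) : c x = x := by
  set h : G → G := fun x => c x * x⁻¹ with hh
  have hsm : ContMDiff (𝓡 n) (𝓡 n) ∞ h := hc.mul (contMDiff_id.inv)
  have hd : MDifferentiable (𝓡 n) (𝓡 n) h := hsm.mdifferentiable (by simp)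
  have hone : HasMFDerivAt (𝓡 n) (𝓡 n) h 1 (0 : EuclideanSpace ℝ (Fin n) →L[ℝ] _) := by
    obtain ⟨D, hD⟩ : ∃ D : EuclideanSpace ℝ (Fin n) →L[ℝ] EuclideanSpace ℝ (Fin n),
      HasMFDerivAt (𝓡 n) (𝓡 n) h 1 D := ⟨_, (hd 1).hasMFDerivAt⟩
    have hprod := hD.prodMk (hasMFDerivAt_id (I := 𝓡 n) (1 : G))
    have hm : MDifferentiableAt ((𝓡 n).prod (𝓡 n)) (𝓡 n) (fun p : G × G => p.1 * p.2)
        (h 1, id 1) := ((contMDiff_mul (𝓡 n) ∞).mdifferentiable (by simp)) _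
    have hcomp := hm.hasMFDerivAt.comp (f := fun y => (h y, id y)) (1 : G) hprod
    -- Since `h x * x = c x`, the product rule at `1` reads `D + id = id`.
    have e : (fun p : G × G => p.1 * p.2) ∘ (fun x => (h x, id x)) = c := by
      ext x; simp [hh]
    rw [e] at hcomp
    have hu := hasMFDerivAt_unique hcomp h1
    have hD0 : D = 0 := by
      ext1 v
      have hv := congrArg (fun T : EuclideanSpace ℝ (Fin n) →L[ℝ] EuclideanSpace ℝ (Fin n) => T v) hu
      have hadd := mfderiv_prod_eq_add_apply (v := (D v, v)) hm
      have hr : ∀ a b : G, a = 1 → HasMFDerivAt (𝓡 n) (𝓡 n) (fun z => z * a) b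
          (ContinuousLinearMap.id ℝ (EuclideanSpace ℝ (Fin n))) := by
        rintro a b rfl
        have e : (fun z : G => z * 1) = id := by ext; simp
        rw [e]; exact hasMFDerivAt_id b
      have hl : ∀ a b : G, a = 1 → HasMFDerivAt (𝓡 n) (𝓡 n) (fun z => a * z) b
          (ContinuousLinearMap.id ℝ (EuclideanSpace ℝ (Fin n))) := by
        rintro a b rfl
        have e : (fun z : G => 1 * z) = id := by ext; simp
        rw [e]; exact hasMFDerivAt_id b
      have hr1 := congrArg (fun T : EuclideanSpace ℝ (Fin n) →L[ℝ] EuclideanSpace ℝ (Fin n) =>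
        T (D v)) (hasMFDerivAt_unique (hr (id 1) (h 1) rfl).mdifferentiableAt.hasMFDerivAt
          (hr (id 1) (h 1) rfl))
      have hl1 := congrArg (fun T : EuclideanSpace ℝ (Fin n) →L[ℝ] EuclideanSpace ℝ (Fin n) =>
        T v) (hasMFDerivAt_unique (hl (h 1) (id 1) (by simp [hh])).mdifferentiableAt.hasMFDerivAt
          (hl (h 1) (id 1) (by simp [hh])))
      have hsum : D v + v = v :=
        (congr (congrArg (fun x y : EuclideanSpace ℝ (Fin n) => x + y) hr1) hl1).symm.trans
          (hadd.symm.trans hv)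
      simpa using hsum
    subst hD0; exact hD
  have hz : ∀ g, HasMFDerivAt (𝓡 n) (𝓡 n) h g (0 : EuclideanSpace ℝ (Fin n) →L[ℝ] _) := by
    intro g
    have hl : HasMFDerivAt (𝓡 n) (𝓡 n) (fun x => g⁻¹ * x) g
        (mfderiv (𝓡 n) (𝓡 n) (fun x => g⁻¹ * x) g) := (mdifferentiable_mul_left g⁻¹ g).hasMFDerivAt
    have h2 : HasMFDerivAt (𝓡 n) (𝓡 n) h (g⁻¹ * g) (0 : EuclideanSpace ℝ (Fin n) →L[ℝ] _) := by
      rwa [inv_mul_cancel]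
    have h3 := h2.comp g hl
    have hlr : MDifferentiable (𝓡 n) (𝓡 n) (fun y => c g * y * g⁻¹) :=
      (mdifferentiable_mul_right (n := n) (g⁻¹)).comp (mdifferentiable_mul_left (n := n) (c g))
    obtain ⟨T, hT⟩ : ∃ T : EuclideanSpace ℝ (Fin n) →L[ℝ] EuclideanSpace ℝ (Fin n),
      HasMFDerivAt (𝓡 n) (𝓡 n) (fun y => c g * y * g⁻¹) ((h ∘ fun x => g⁻¹ * x) g) T :=
      ⟨_, (hlr _).hasMFDerivAt⟩
    have h4 := hT.comp g h3
    -- The cocycle identity `h x = c g * h (g⁻¹ x) * g⁻¹` carries the vanishing of the differential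
    -- from `1` to `g`.
    have e : (fun y => c g * y * g⁻¹) ∘ h ∘ (fun x => g⁻¹ * x) = h := by
      ext x; simp [hh, mul_assoc]
    rw [e] at h4
    refine h4.congr_mfderiv ?_
    ext1 v
    exact T.map_zero
  have hlc := isLocallyConstant_of_hasMFDerivAt_zero hz
  have := hlc.apply_eq_of_isPreconnected isPreconnected_univ (mem_univ x) (mem_univ 1)
  simpa [hh, mul_inv_eq_one] using this

end FlagManifold
end

/-! ### Linear algebra of definite forms; simple Lie algebras with definite Killing form. -/

noncomputable section

namespace FlagManifold

section LinearAlgebra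

variable {E : Type*} [AddCommGroup E] [Module ℝ E]

/-- The inner product space structure defined by a positive definite symmetric form. -/
@[reducible] def innerProductCore (B : LinearMap.BilinForm ℝ E) (hs : ∀ x y, B x y = B y x)
    (hp : ∀ x, x ≠ 0 → 0 < B x x) : InnerProductSpace.Core ℝ E where
  inner x y := B x y
  conj_inner_symm x y := by simp [hs y x]
  re_inner_nonneg x := by
    by_cases h : x = 0
    · simp [h]
    · simpa using (hp x h).le
  add_left x y z := by simp
  smul_left x y r := by simp
  definite x h := by
    by_contra hx
    exact (hp x hx).ne' h

/-- The square of an endomorphism that is skew for an inner product has nonpositive trace, and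
the trace vanishes only if the endomorphism does. -/
lemma trace_sq_of_skew [FiniteDimensional ℝ E] (B : LinearMap.BilinForm ℝ E)
    (hs : ∀ x y, B x y = B y x) (hp : ∀ x, x ≠ 0 → 0 < B x x) (T : E →ₗ[ℝ] E)
    (hT : ∀ x y, B (T x) y = -B x (T y)) :
    LinearMap.trace ℝ E (T ∘ₗ T) ≤ 0 ∧ (LinearMap.trace ℝ E (T ∘ₗ T) = 0 → T = 0) := by
  let core := innerProductCore B hs hp
  let _ : NormedAddCommGroup E := core.toNormedAddCommGroup
  let _ : InnerProductSpace ℝ E := InnerProductSpace.ofCore core.toCore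
  let b := stdOrthonormalBasis ℝ E
  have hpos : ∀ x, 0 ≤ B x x := fun x => by
    by_cases h : x = 0
    · simp [h]
    · exact (hp x h).le
  have htr : LinearMap.trace ℝ E (T ∘ₗ T) = - ∑ i, B (T (b i)) (T (b i)) := by
    rw [LinearMap.trace_eq_sum_inner _ b, ← Finset.sum_neg_distrib]
    refine Finset.sum_congr rfl fun i _ => ?_
    have : B (T (b i)) (T (b i)) = - B (b i) (T (T (b i))) := hT _ _
    rw [this, neg_neg]
    rfl
  rw [htr]
  refine ⟨neg_nonpos.2 (Finset.sum_nonneg fun i _ => hpos _), fun h => ?_⟩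
  rw [neg_eq_zero, Finset.sum_eq_zero_iff_of_nonneg fun i _ => hpos _] at h
  refine b.toBasis.ext fun i => ?_
  by_contra hne
  refine (hp _ ?_).ne' (h i (Finset.mem_univ i))
  simpa using hne

/-- An endomorphism of a nonzero finite dimensional real space that is symmetric for an inner
product has an eigenvector. -/
lemma exists_eigenvector_of_symmetric [FiniteDimensional ℝ E] [Nontrivial E]
    (B : LinearMap.BilinForm ℝ E)
    (hs : ∀ x y, B x y = B y x) (hp : ∀ x, x ≠ 0 → 0 < B x x) (T : E →ₗ[ℝ] E)
    (hT : ∀ x y, B (T x) y = B x (T y)) : ∃ (c : ℝ) (v : E), v ≠ 0 ∧ T v = c • v := by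
  let core := innerProductCore B hs hp
  let _ : NormedAddCommGroup E := core.toNormedAddCommGroup
  let _ : InnerProductSpace ℝ E := InnerProductSpace.ofCore core.toCore
  have hsym : T.IsSymmetric := fun x y => hT x y
  obtain ⟨v, hv⟩ := hsym.hasEigenvalue_iSup_of_finiteDimensional.exists_hasEigenvector
  exact ⟨_, v, hv.2, hv.apply_eq_smul⟩

lemma exists_eigenvector_of_symmetricOn [FiniteDimensional ℝ E] (B : LinearMap.BilinForm ℝ E)
    {V : Submodule ℝ E} (hV : V ≠ ⊥)
    (hs : ∀ x y, B x y = B y x) (hp : ∀ x, x ≠ 0 → 0 < B x x) {T : E →ₗ[ℝ] E}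
    (hTV : ∀ x ∈ V, T x ∈ V)
    (hT : ∀ x ∈ V, ∀ y ∈ V, B (T x) y = B x (T y)) : ∃ (c : ℝ), ∃ v ∈ V, v ≠ 0 ∧ T v = c • v := by
  have : Nontrivial V := Submodule.nontrivial_iff_ne_bot.2 hV
  obtain ⟨c, v, hv, h⟩ := exists_eigenvector_of_symmetric (B.restrict V)
    (fun x y => hs x y) (fun x hx => hp x (by simpa using hx)) (T.restrict hTV)
    (fun x y => hT x x.2 y y.2)
  exact ⟨c, v, v.2, by simpa using hv, congrArg Subtype.val h⟩

/-- Orthogonal decomposition for a definite form. -/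
lemma exists_add_of_definite [FiniteDimensional ℝ E] (B : LinearMap.BilinForm ℝ E)
    (hs : ∀ x y, B x y = B y x) (hp : ∀ x, x ≠ 0 → B x x ≠ 0) (U : Submodule ℝ E) (x : E) :
    ∃ u ∈ U, ∃ v, (∀ y ∈ U, B y v = 0) ∧ x = u + v := by
  have hrefl : B.IsRefl := fun x y h => by rw [hs]; exact h
  have hc : IsCompl U (B.orthogonal U) := by
    rw [LinearMap.BilinForm.isCompl_orthogonal_iff_disjoint hrefl, Submodule.disjoint_def]
    intro x hx hx'
    by_contra hne
    exact hp x hne (hx' x hx)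
  obtain ⟨u, hu, v, hv, h⟩ := Submodule.mem_sup.1 (hc.sup_eq_top ▸ Submodule.mem_top (x := x))
  exact ⟨u, hu, v, fun y hy => hv y hy, h.symm⟩

end LinearAlgebra

section LieAlgebra

variable {L : Type*} [LieRing L] [LieAlgebra ℝ L]

lemma killingForm_lie_left (x y z : L) : killingForm ℝ L ⁅x, y⁆ z = killingForm ℝ L x ⁅y, z⁆ :=
  LieModule.traceForm_apply_lie_apply ℝ L L x y z

lemma killingForm_lie_left' (x y z : L) : killingForm ℝ L ⁅x, y⁆ z = -killingForm ℝ L y ⁅x, z⁆ :=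
  LieModule.traceForm_apply_lie_apply' ℝ L L x y z

lemma killingForm_symm (x y : L) : killingForm ℝ L x y = killingForm ℝ L y x :=
  LieModule.traceForm_comm ℝ L L x y

/-- In a simple Lie algebra an element with trivial bracket vanishes. -/
lemma eq_zero_of_forall_lie_eq_zero [LieAlgebra.IsSimple ℝ L] {x : L} (h : ∀ y : L, ⁅x, y⁆ = 0) :
    x = 0 := by
  have hx : x ∈ LieAlgebra.center ℝ L := by
    rw [LieModule.mem_maxTrivSubmodule]
    intro y
    rw [← lie_skew, h, neg_zero]
  rcases LieAlgebra.IsSimple.eq_bot_or_eq_top (R := ℝ) (LieAlgebra.center ℝ L) with hb | ht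
  · rw [hb] at hx
    simpa using hx
  · exact absurd ((LieAlgebra.isLieAbelian_iff_center_eq_top ℝ L).2 ht)
      (LieAlgebra.IsSimple.non_abelian (R := ℝ))

/-- Let `L = k ⊕ m` be an orthogonal decomposition of a simple Lie algebra with definite Killing
form and `[m, m] ⊆ k`. Then `m` has no proper `k`-submodule except `0`. -/
lemma eq_of_lie_stable [FiniteDimensional ℝ L] [LieAlgebra.IsSimple ℝ L]
    (hneg : ∀ x : L, x ≠ 0 → killingForm ℝ L x x ≠ 0) {k m V : Submodule ℝ L}
    (hm : ∀ x, x ∈ m ↔ ∀ y ∈ k, killingForm ℝ L y x = 0)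
    (hmm : ∀ x ∈ m, ∀ y ∈ m, ⁅x, y⁆ ∈ k) (hVm : V ≤ m) (hV0 : V ≠ ⊥)
    (hkV : ∀ x ∈ k, ∀ y ∈ V, ⁅x, y⁆ ∈ V) : V = m := by
  -- Here `[w, v] ∈ k`, so `[v, [w, v]] ∈ V` is orthogonal to `w`. By invariance `[w, v]` has
  -- Killing norm zero.
  have horth : ∀ v ∈ V, ∀ w ∈ m, (∀ y ∈ V, killingForm ℝ L y w = 0) → ⁅w, v⁆ = 0 := by
    intro v hv w hw hw'
    by_contra hne
    have hz := hmm w hw v (hVm hv)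
    apply hneg _ hne
    have h1 : killingForm ℝ L ⁅w, v⁆ ⁅w, v⁆ = killingForm ℝ L w ⁅v, ⁅w, v⁆⁆ :=
      killingForm_lie_left w v _
    rw [h1, killingForm_symm, ← lie_skew, map_neg, LinearMap.neg_apply, hw' _ (hkV _ hz v hv),
      neg_zero]
  -- The sum of `V ⊆ m` and `D = [V, V] ⊆ k` turns out to be an ideal.
  let D : Submodule ℝ L := Submodule.span ℝ {z | ∃ a ∈ V, ∃ b ∈ V, ⁅a, b⁆ = z}
  have hDk : D ≤ k := by
    refine Submodule.span_le.2 ?_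
    rintro z ⟨a, ha, b, hb, rfl⟩
    exact hmm a (hVm ha) b (hVm hb)
  have hxV : ∀ x : L, ∀ v ∈ V, ⁅x, v⁆ ∈ V ⊔ D := by
    intro x v hv
    -- Split `x` along `k`, `V` and the complement of `V` in `m`: the first preserves `V`, the
    -- second maps `V` into `D`, the third annihilates `V`.
    obtain ⟨κ, hκ, μ, hμ, rfl⟩ := exists_add_of_definite (killingForm ℝ L) killingForm_symm hneg k x
    obtain ⟨u, hu, w, hw, rfl⟩ := exists_add_of_definite (killingForm ℝ L) killingForm_symm hneg V μ
    have hwm : w ∈ m := by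
      have : u + w ∈ m := (hm _).2 hμ
      simpa using m.sub_mem this (hVm hu)
    rw [add_lie, add_lie, horth v hv w hwm hw, add_zero]
    exact Submodule.add_mem_sup (hkV κ hκ v hv) (Submodule.subset_span ⟨u, hu, v, hv, rfl⟩)
  have hVD : ∀ y ∈ V ⊔ D, ∀ v ∈ V, ⁅y, v⁆ ∈ V ⊔ D := fun y _ v hv => hxV y v hv
  have hideal : ∀ x : L, ∀ y ∈ V ⊔ D, ⁅x, y⁆ ∈ V ⊔ D := by
    intro x y hy
    obtain ⟨v, hv, d, hd, rfl⟩ := Submodule.mem_sup.1 hy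
    rw [lie_add]
    refine Submodule.add_mem _ (hxV x v hv) ?_
    induction hd using Submodule.span_induction with
    | mem z hz =>
      obtain ⟨a, ha, b, hb, rfl⟩ := hz
      rw [leibniz_lie]
      refine Submodule.add_mem _ (hxV _ b hb) ?_
      rw [← lie_skew]
      exact Submodule.neg_mem _ (hxV _ a ha)
    | zero => simp
    | add z w _ _ hz hw =>
      rw [lie_add]
      exact Submodule.add_mem _ (hz (Submodule.add_mem_sup hv ‹_›)) (hw (Submodule.add_mem_sup hv ‹_›))
    | smul c z _ hz =>
      rw [lie_smul]
      exact Submodule.smul_mem _ _ (hz (Submodule.add_mem_sup hv ‹_›))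
  let I : LieIdeal ℝ L := { V ⊔ D with lie_mem := fun {x y} hy => hideal x y hy }
  have hI : I = ⊤ := by
    rcases LieAlgebra.IsSimple.eq_bot_or_eq_top (R := ℝ) I with hb | ht
    · exfalso
      apply hV0
      rw [eq_bot_iff]
      intro v hv
      have : v ∈ I := (Submodule.mem_sup_left hv : v ∈ V ⊔ D)
      rw [hb] at this
      simpa using this
    · exact ht
  refine le_antisymm hVm fun x hx => ?_
  have hxI : x ∈ I := by rw [hI]; exact LieSubmodule.mem_top x
  obtain ⟨v, hv, d, hd, rfl⟩ := Submodule.mem_sup.1 (show x ∈ V ⊔ D from hxI)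
  have hdm : d ∈ m := by simpa using m.sub_mem hx (hVm hv)
  have hd0 : d = 0 := by
    by_contra hne
    exact hneg d hne ((hm d).1 hdm d (hDk hd))
  simpa [hd0] using hv

/-- For commuting derivations `x`, `y` with `(ad x)³ = -ad x` and `(ad y)² = (ad x)²`, the number
`φ(y, x) - φ(x, x)` is an even natural number. -/
lemma exists_nat_killingForm_sub [FiniteDimensional ℝ L] {x y : L} (hxy : ⁅x, y⁆ = 0)
    (hx : ∀ z : L, ⁅x, ⁅x, ⁅x, z⁆⁆⁆ = -⁅x, z⁆)
    (hy : ∀ z : L, ⁅y, ⁅y, z⁆⁆ = ⁅x, ⁅x, z⁆⁆) :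
    ∃ r : ℕ, killingForm ℝ L y x - killingForm ℝ L x x = 2 * r := by
  have hcomm : ∀ z : L, ⁅x, ⁅y, z⁆⁆ = ⁅y, ⁅x, z⁆⁆ := by
    intro z; rw [leibniz_lie, hxy, zero_lie, zero_add]
  -- The map `E = -(ad x)²` is a projection and `T = ad y ∘ ad x` satisfies `T² = E`. So `P = (T +
  -- E)/2` is the projection onto the `+1` eigenspace of `T`. Its trace is its rank, and twice its
  -- trace is `φ(y, x) - φ(x, x)`.
  let P : L →ₗ[ℝ] L := (2⁻¹ : ℝ) • ((LieAlgebra.ad ℝ L y : L →ₗ[ℝ] L) ∘ₗ (LieAlgebra.ad ℝ L x : L →ₗ[ℝ] L) -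
    (LieAlgebra.ad ℝ L x : L →ₗ[ℝ] L) ∘ₗ (LieAlgebra.ad ℝ L x : L →ₗ[ℝ] L))
  have hP : ∀ z, P z = (2⁻¹ : ℝ) • (⁅y, ⁅x, z⁆⁆ - ⁅x, ⁅x, z⁆⁆) := fun z => rfl
  have hid : IsIdempotentElem P := by
    ext z
    change P (P z) = P z
    rw [hP (P z), hP z]
    simp only [lie_smul, lie_sub, smul_sub, hcomm, hx, hy, lie_neg]
    module
  refine ⟨Module.finrank ℝ (LinearMap.range P), ?_⟩
  rw [← (LinearMap.IsIdempotentElem.isProj_range P hid).trace]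
  simp only [P, map_smul, map_sub, smul_eq_mul,
    ← killingForm_apply_apply]
  ring

end LieAlgebra

end FlagManifold
end

/-! ### Invariant inner products, definiteness of the Killing form, and `Ad` by automorphisms. -/

noncomputable section

namespace FlagManifold

open Set Filter Topology MeasureTheory

variable {n : ℕ} {G : Type*} [TopologicalSpace G] [ChartedSpace (EuclideanSpace ℝ (Fin n)) G]
  [Group G] [LieGroup (𝓡 n) ∞ G] [T2Space G]

instance : FiniteDimensional ℝ (GroupLieAlgebra (𝓡 n) G) :=
  inferInstanceAs (FiniteDimensional ℝ (EuclideanSpace ℝ (Fin n)))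

instance : Module.Free ℝ (GroupLieAlgebra (𝓡 n) G) :=
  inferInstanceAs (Module.Free ℝ (EuclideanSpace ℝ (Fin n)))

/-- The standard inner product of the model space, as a bilinear form on the Lie algebra. -/
lemma exists_inner_form : ∃ B : LinearMap.BilinForm ℝ (GroupLieAlgebra (𝓡 n) G),
    (∀ X Y, B X Y = B Y X) ∧ ∀ X, X ≠ 0 → 0 < B X X :=
  ⟨(innerₗ (EuclideanSpace ℝ (Fin n)) : EuclideanSpace ℝ (Fin n) →ₗ[ℝ]
      EuclideanSpace ℝ (Fin n) →ₗ[ℝ] ℝ),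
    fun X Y => real_inner_comm (F := EuclideanSpace ℝ (Fin n)) Y X,
    fun _ hX => (real_inner_self_pos (F := EuclideanSpace ℝ (Fin n))).2 hX⟩

lemma exists_Ad_invariant_form [CompactSpace G] :
    ∃ B : LinearMap.BilinForm ℝ (GroupLieAlgebra (𝓡 n) G),
      (∀ X Y, B X Y = B Y X) ∧ (∀ X, X ≠ 0 → 0 < B X X) ∧
      ∀ (a : G) (X Y), B (Ad n a X) (Ad n a Y) = B X Y := by
  obtain ⟨B0, hs, hp⟩ := exists_inner_form (n := n) (G := G)
  have : IsTopologicalGroup G := topologicalGroup_of_lieGroup (𝓡 n) ∞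
  let _ : MeasurableSpace G := borel G
  have : BorelSpace G := ⟨rfl⟩
  let μ : Measure G := Measure.haar
  have hc : ∀ X Y : GroupLieAlgebra (𝓡 n) G,
      Continuous (fun g : G => B0 (Ad n g⁻¹ X) (Ad n g⁻¹ Y)) := fun X Y =>
    (continuous_bilin_Ad B0 X Y).comp continuous_inv
  have hi : ∀ X Y : GroupLieAlgebra (𝓡 n) G,
      Integrable (fun g : G => B0 (Ad n g⁻¹ X) (Ad n g⁻¹ Y)) μ := fun X Y =>
    (hc X Y).integrable_of_hasCompactSupport (HasCompactSupport.of_compactSpace _)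
  let B : LinearMap.BilinForm ℝ (GroupLieAlgebra (𝓡 n) G) := LinearMap.mk₂ ℝ
    -- The inverse makes left invariance of Haar measure suffice: replacing `g` by `a * g` cancels
    -- `Ad a`.
    (fun X Y => ∫ g, B0 (Ad n g⁻¹ X) (Ad n g⁻¹ Y) ∂μ)
    (fun X X' Y => by
      rw [← integral_add (hi _ _) (hi _ _)]
      simp only [map_add, LinearMap.add_apply])
    (fun c X Y => by
      rw [← integral_smul]
      simp only [map_smul, LinearMap.smul_apply])
    (fun X Y Y' => by
      rw [← integral_add (hi _ _) (hi _ _)]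
      simp only [map_add])
    (fun c X Y => by
      rw [← integral_smul]
      simp only [map_smul])
  have hB : ∀ X Y, B X Y = ∫ g, B0 (Ad n g⁻¹ X) (Ad n g⁻¹ Y) ∂μ := fun X Y => rfl
  refine ⟨B, fun X Y => ?_, fun X hX => ?_, fun a X Y => ?_⟩
  · rw [hB, hB]
    exact integral_congr_ae (Eventually.of_forall fun g => hs _ _)
  · rw [hB]
    have hne : ∀ g : G, Ad n g⁻¹ X ≠ 0 := fun g h => hX (by
      rw [← Ad_apply_inv_self g X, h, map_zero])
    exact (hc X X).integral_pos_of_hasCompactSupport_nonneg_nonzero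
      (HasCompactSupport.of_compactSpace _) (fun g => (hp _ (hne g)).le) (x := 1)
      (hp _ (hne 1)).ne'
  · rw [hB, hB, ← integral_mul_left_eq_self _ a]
    refine integral_congr_ae (Eventually.of_forall fun g => ?_)
    simp only [← Ad_mul_apply]
    simp

/-- The Killing form of a compact simple Lie group is negative definite. -/
lemma killingForm_neg [CompactSpace G] [LieAlgebra.IsSimple ℝ (GroupLieAlgebra (𝓡 n) G)]
    (X : GroupLieAlgebra (𝓡 n) G) (hX : X ≠ 0) :
    killingForm ℝ (GroupLieAlgebra (𝓡 n) G) X X < 0 := by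
  obtain ⟨B, hs, hp, hB⟩ := exists_Ad_invariant_form (n := n) (G := G)
  obtain ⟨γ, h0, hγ⟩ := exists_isMIntegralCurve_mulInvariant X
  -- Differentiating the invariance of `B` along `exp (tX)` makes `ad X` skew, so `φ(X, X)` is the
  -- trace of the square of a skew map.
  have hskew : ∀ Y Z, B ⁅X, Y⁆ Z = -B Y ⁅X, Z⁆ := by
    intro Y Z
    have h1 := hasDerivAt_bilin_Ad h0 hγ Y Z B
    simp only [hB] at h1
    linarith [h1.unique (hasDerivAt_const (0 : ℝ) (B Y Z))]
  obtain ⟨hle, hz⟩ := trace_sq_of_skew B hs hp (LieAlgebra.ad ℝ _ X) hskew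
  rw [killingForm_apply_apply]
  refine lt_of_le_of_ne hle fun h => hX (eq_zero_of_forall_lie_eq_zero fun Y => ?_)
  exact congrArg (fun T => T Y) (hz h)

/-- The differential at `1` of a homomorphism intertwines the adjoint representations. -/
lemma apply_Ad_of_hasMFDerivAt {c : G →* G}
    {C : EuclideanSpace ℝ (Fin n) →L[ℝ] EuclideanSpace ℝ (Fin n)}
    (hC : HasMFDerivAt (𝓡 n) (𝓡 n) c 1 C) (a : G) (X : GroupLieAlgebra (𝓡 n) G) :
    C (Ad n a X) = Ad n (c a) (show GroupLieAlgebra (𝓡 n) G from C X) := by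
  have h1 := hasMFDerivAt_conj (n := n) a
  have h2 := hasMFDerivAt_conj (n := n) (c a)
  have hC' : HasMFDerivAt (𝓡 n) (𝓡 n) c (a * 1 * a⁻¹) C := by
    rwa [show a * 1 * a⁻¹ = 1 by simp]
  have h2' : HasMFDerivAt (𝓡 n) (𝓡 n) (fun x => c a * x * (c a)⁻¹) (c 1) (AdE n (c a)) := by
    rwa [map_one]
  have h3 := hC'.comp (1 : G) h1
  have h4 := h2'.comp (1 : G) hC
  have e : (c ∘ fun x => a * x * a⁻¹) = (fun x => c a * x * (c a)⁻¹) ∘ c := by ext x; simp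
  rw [e] at h3
  exact congrArg (fun T : EuclideanSpace ℝ (Fin n) →L[ℝ] EuclideanSpace ℝ (Fin n) => T X)
    (hasMFDerivAt_unique h3 h4)

/-- The differential at `1` of a homomorphism is a homomorphism of Lie algebras. -/
lemma apply_lie_of_hasMFDerivAt {c : G →* G} (hc : MDifferentiable (𝓡 n) (𝓡 n) c)
    {C : GroupLieAlgebra (𝓡 n) G →L[ℝ] GroupLieAlgebra (𝓡 n) G}
    (hC : HasMFDerivAt (𝓡 n) (𝓡 n) c 1
      (show EuclideanSpace ℝ (Fin n) →L[ℝ] EuclideanSpace ℝ (Fin n) from C))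
    (X Y : GroupLieAlgebra (𝓡 n) G) : C ⁅X, Y⁆ = ⁅C X, C Y⁆ := by
  obtain ⟨γ, h0, hγ⟩ := exists_isMIntegralCurve_mulInvariant X
  have hγ' := isMIntegralCurve_comp_hom hc hC hγ
  have h0' : (c ∘ γ) 0 = 1 := by simp [h0]
  rw [← sub_eq_zero, ← Module.forall_dual_apply_eq_zero_iff ℝ]
  intro l
  have h1 := hasDerivAt_apply_Ad h0 hγ Y (l ∘ₗ (C : GroupLieAlgebra (𝓡 n) G →ₗ[ℝ] _))
  have h2 := hasDerivAt_apply_Ad h0' hγ' (C Y) l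
  -- The same function of `t` is differentiated in two ways, using `C ∘ Ad (γ t) = Ad (c (γ t)) ∘
  -- C`.
  have e : (fun t => (l ∘ₗ (C : GroupLieAlgebra (𝓡 n) G →ₗ[ℝ] _)) (Ad n (γ t) Y)) =
      fun t => l (Ad n ((c ∘ γ) t) (C Y)) := by
    ext t
    exact congrArg l (apply_Ad_of_hasMFDerivAt hC (γ t) Y)
  rw [e] at h1
  rw [map_sub, sub_eq_zero]
  exact h1.unique h2

/-- A bijective endomorphism of a Lie algebra preserves the Killing form. -/
lemma killingForm_apply_of_inverse {L : Type*} [LieRing L] [LieAlgebra ℝ L]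
    (C C' : L →ₗ[ℝ] L) (hC : ∀ x y, C ⁅x, y⁆ = ⁅C x, C y⁆) (h : ∀ x, C' (C x) = x)
    (h' : ∀ x, C (C' x) = x) (x y : L) :
    killingForm ℝ L (C x) (C y) = killingForm ℝ L x y :=
  let e : L ≃ₗ⁅ℝ⁆ L :=
    { C with
      map_lie' := fun {x y} => hC x y
      invFun := C'
      left_inv := h
      right_inv := h' }
  LieAlgebra.killingForm_of_equiv_apply e x y

lemma hasMFDerivAt_conjHom (a : G) :
    HasMFDerivAt (𝓡 n) (𝓡 n) (MulAut.conj a).toMonoidHom 1 (AdE n a) :=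
  hasMFDerivAt_conj a

lemma Ad_lie (a : G) (X Y : GroupLieAlgebra (𝓡 n) G) : Ad n a ⁅X, Y⁆ = ⁅Ad n a X, Ad n a Y⁆ := by
  let C : GroupLieAlgebra (𝓡 n) G →L[ℝ] GroupLieAlgebra (𝓡 n) G := Ad n a
  exact apply_lie_of_hasMFDerivAt (C := C) (mdifferentiable_conj (n := n) a)
    (hasMFDerivAt_conjHom a) X Y

lemma killingForm_Ad (a : G) (X Y : GroupLieAlgebra (𝓡 n) G) :
    killingForm ℝ (GroupLieAlgebra (𝓡 n) G) (Ad n a X) (Ad n a Y) =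
      killingForm ℝ (GroupLieAlgebra (𝓡 n) G) X Y := by
  let C : G → GroupLieAlgebra (𝓡 n) G →ₗ[ℝ] GroupLieAlgebra (𝓡 n) G := fun a => Ad n a
  exact killingForm_apply_of_inverse (C a) (C a⁻¹) (Ad_lie a) (Ad_inv_apply_self a)
    (Ad_apply_inv_self a) X Y

/-- In a connected Lie group the kernel of `Ad` is the centre. -/
lemma commute_of_Ad_eq [ConnectedSpace G] {a : G}
    (ha : ∀ X : GroupLieAlgebra (𝓡 n) G, Ad n a X = X) (x : G) : a * x = x * a := by
  have h : HasMFDerivAt (𝓡 n) (𝓡 n) (MulAut.conj a).toMonoidHom 1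
      (ContinuousLinearMap.id ℝ (EuclideanSpace ℝ (Fin n))) := by
    have e : AdE n a = ContinuousLinearMap.id ℝ _ := by ext1 X; exact ha X
    rw [← e]; exact hasMFDerivAt_conjHom a
  have := hom_eq_self_of_hasMFDerivAt_id (n := n) (c := (MulAut.conj a).toMonoidHom)
    (contMDiff_conj a) h x
  have h2 : a * x * a⁻¹ = x := this
  rwa [mul_inv_eq_iff_eq_mul] at h2

end FlagManifold
end

/-! ### Centralizers, symmetric pairs and one-parameter groups of a torus. -/

noncomputable section

namespace FlagManifold

open Set Filter Topology

variable {n : ℕ} {G : Type*} [TopologicalSpace G] [ChartedSpace (EuclideanSpace ℝ (Fin n)) G]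
  [Group G] [LieGroup (𝓡 n) ∞ G] [T2Space G]

/-- Equality of vectors of the Lie algebra can be tested on linear forms. -/
lemma ext_dual {X Y : GroupLieAlgebra (𝓡 n) G}
    (h : ∀ l : Module.Dual ℝ (GroupLieAlgebra (𝓡 n) G), l X = l Y) : X = Y := by
  rw [← sub_eq_zero, ← Module.forall_dual_apply_eq_zero_iff ℝ]
  intro l
  rw [map_sub, h l, sub_self]

lemma isMIntegralCurve_conj {γ : ℝ → G} {X : GroupLieAlgebra (𝓡 n) G} (a : G)
    (hγ : IsMIntegralCurve (I := 𝓡 n) γ (mulInvariantVectorField X)) :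
    IsMIntegralCurve (I := 𝓡 n) (fun t => a * γ t * a⁻¹) (mulInvariantVectorField (Ad n a X)) :=
  isMIntegralCurve_comp_hom (c := (MulAut.conj a).toMonoidHom) (mdifferentiable_conj (n := n) a)
    (hasMFDerivAt_conjHom a) hγ

lemma eq_of_isMIntegralCurve {γ : ℝ → G} {X Y : GroupLieAlgebra (𝓡 n) G} (h0 : γ 0 = 1)
    (hX : IsMIntegralCurve (I := 𝓡 n) γ (mulInvariantVectorField X))
    (hY : IsMIntegralCurve (I := 𝓡 n) γ (mulInvariantVectorField Y)) : X = Y := by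
  have h := hasMFDerivAt_unique (hasMFDerivAt_zero_of_isMIntegralCurve h0 hX)
    (hasMFDerivAt_zero_of_isMIntegralCurve h0 hY)
  have h1 : (1 : ℝ) • (show EuclideanSpace ℝ (Fin n) from X) =
      (1 : ℝ) • (show EuclideanSpace ℝ (Fin n) from Y) :=
    congrArg (fun T : ℝ →L[ℝ] EuclideanSpace ℝ (Fin n) => T 1) h
  rwa [one_smul, one_smul] at h1

lemma Ad_eq_self_of_commute {γ : ℝ → G} {X : GroupLieAlgebra (𝓡 n) G} (h0 : γ 0 = 1)
    (hX : IsMIntegralCurve (I := 𝓡 n) γ (mulInvariantVectorField X)) {a : G}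
    (ha : ∀ t, a * γ t = γ t * a) : Ad n a X = X := by
  have h := isMIntegralCurve_conj a hX
  simp only [ha, mul_inv_cancel_right] at h
  exact eq_of_isMIntegralCurve h0 h hX

/-- The curves `γ` and `a γ a⁻¹` pass through `1` and integrate the same left invariant field, so
uniqueness identifies them. -/
lemma commute_of_Ad_eq_self {γ : ℝ → G} {X : GroupLieAlgebra (𝓡 n) G} (h0 : γ 0 = 1)
    (hX : IsMIntegralCurve (I := 𝓡 n) γ (mulInvariantVectorField X)) {a : G}
    (ha : Ad n a X = X) (t : ℝ) : a * γ t = γ t * a := by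
  have h := isMIntegralCurve_conj a hX
  rw [ha] at h
  have := congrFun (isMIntegralCurve_mulInvariant_unique h hX (by simp [h0])) t
  rwa [mul_inv_eq_iff_eq_mul] at this

/-- The Lie algebra of a centralizer is the space of fixed vectors. -/
lemma mem_lieAlgebraOf_centralizer_iff {S : Subgroup G} {X : GroupLieAlgebra (𝓡 n) G} :
    X ∈ lieAlgebraOf n (Subgroup.centralizer (S : Set G)) ↔ ∀ s ∈ S, Ad n s X = X := by
  constructor
  · rintro ⟨γ, h0, hγ, hK⟩ s hs
    exact Ad_eq_self_of_commute h0 hγ fun t => Subgroup.mem_centralizer_iff.1 (hK t) s hs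
  · intro h
    obtain ⟨γ, h0, hγ⟩ := exists_isMIntegralCurve_mulInvariant X
    exact ⟨γ, h0, hγ, fun t => Subgroup.mem_centralizer_iff.2 fun s hs =>
      commute_of_Ad_eq_self h0 hγ (h s hs) t⟩

lemma mem_isotropyModule {K : Subgroup G} {X : GroupLieAlgebra (𝓡 n) G} :
    X ∈ isotropyModule n K ↔
      ∀ Y ∈ lieAlgebraOf n K, killingForm ℝ (GroupLieAlgebra (𝓡 n) G) Y X = 0 := Iff.rfl

/-- The bracket is the velocity at `0` of `t ↦ Ad (γ t) Y`, a curve that stays in `W`; membership is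
tested on the annihilator of `W`. -/
lemma lie_mem_of_isAdInvariant {K : Subgroup G} {W : Submodule ℝ (GroupLieAlgebra (𝓡 n) G)}
    (hW : IsAdInvariant K W) {X Y : GroupLieAlgebra (𝓡 n) G} (hX : X ∈ lieAlgebraOf n K)
    (hY : Y ∈ W) : ⁅X, Y⁆ ∈ W := by
  obtain ⟨γ, h0, hγ, hK⟩ := hX
  refine (Subspace.forall_mem_dualAnnihilator_apply_eq_zero_iff W _).1 fun l hl => ?_
  have h := hasDerivAt_apply_Ad h0 hγ Y l
  have hz : (fun t => l (Ad n (γ t) Y)) = fun _ => 0 := by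
    ext t
    exact (Submodule.mem_dualAnnihilator l).1 hl _ (hW _ (hK t) _ hY)
  rw [hz] at h
  exact h.unique (hasDerivAt_const _ _)

lemma lie_eq_zero_of_Ad_eq {γ : ℝ → G} {X Y : GroupLieAlgebra (𝓡 n) G} (h0 : γ 0 = 1)
    (hX : IsMIntegralCurve (I := 𝓡 n) γ (mulInvariantVectorField X))
    (h : ∀ t, Ad n (γ t) Y = Y) : ⁅X, Y⁆ = 0 := by
  refine ext_dual fun l => ?_
  have hd := hasDerivAt_apply_Ad h0 hX Y l
  simp only [h] at hd
  rw [map_zero]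
  exact hd.unique (hasDerivAt_const _ _)

/-- The differential `dσ` of an involution whose fixed point group has identity component in `K`
is `-1` on the isotropy module; consequently `[𝔪, 𝔪] ⊆ 𝔨`. -/
lemma lie_mem_lieAlgebraOf_of_isSymmetricPair [CompactSpace G]
    [LieAlgebra.IsSimple ℝ (GroupLieAlgebra (𝓡 n) G)] {K : Subgroup G}
    (h : IsSymmetricPair n K) {X Y : GroupLieAlgebra (𝓡 n) G} (hX : X ∈ isotropyModule n K)
    (hY : Y ∈ isotropyModule n K) : ⁅X, Y⁆ ∈ lieAlgebraOf n K := by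
  obtain ⟨σ, hσ, hinv, hfix, -⟩ := h
  let c : G →* G := σ.toMonoidHom
  have hcd : MDifferentiable (𝓡 n) (𝓡 n) c := hσ.mdifferentiable (by simp)
  obtain ⟨C, hC⟩ : ∃ C : EuclideanSpace ℝ (Fin n) →L[ℝ] EuclideanSpace ℝ (Fin n),
      HasMFDerivAt (𝓡 n) (𝓡 n) c 1 C := ⟨_, (hcd 1).hasMFDerivAt⟩
  let C' : GroupLieAlgebra (𝓡 n) G →L[ℝ] GroupLieAlgebra (𝓡 n) G := C
  have hlie : ∀ X Y, C' ⁅X, Y⁆ = ⁅C' X, C' Y⁆ := apply_lie_of_hasMFDerivAt (C := C') hcd hC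
  have hCC : ∀ X, C' (C' X) = X := by
    have h1 : HasMFDerivAt (𝓡 n) (𝓡 n) c (c 1) C := by rwa [map_one]
    have h2 := h1.comp (1 : G) hC
    have e : c ∘ c = id := by ext x; exact hinv x
    rw [e] at h2
    intro X
    exact congrArg (fun T : EuclideanSpace ℝ (Fin n) →L[ℝ] EuclideanSpace ℝ (Fin n) => T X)
      (hasMFDerivAt_unique h2 (hasMFDerivAt_id (1 : G)))
  have hmem : ∀ X, C' X = X → X ∈ lieAlgebraOf n K := by
    intro X hX
    obtain ⟨γ, h0, hγ⟩ := exists_isMIntegralCurve_mulInvariant X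
    have h1 := isMIntegralCurve_comp_hom hcd hC hγ
    have h2 : IsMIntegralCurve (I := 𝓡 n) (c ∘ γ) (mulInvariantVectorField X) := by
      rw [← hX]; exact h1
    have h3 := isMIntegralCurve_mulInvariant_unique h2 hγ (by simp [h0])
    refine ⟨γ, h0, hγ, fun t => hfix ?_⟩
    have hsub : Set.range γ ⊆ connectedComponentIn {x | σ x = x} 1 :=
      (isPreconnected_range hγ.continuous).subset_connectedComponentIn ⟨0, h0⟩
        (by rintro _ ⟨t, rfl⟩; exact congrFun h3 t)
    exact hsub ⟨t, rfl⟩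
  have hneg : ∀ X ∈ isotropyModule n K, C' X = -X := by
    intro X hX
    -- The vector `u = X + dσ X` is fixed by `dσ`, hence in `𝔨` and orthogonal to `X`. As `dσ`
    -- preserves `φ`, it is also orthogonal to `dσ X`; so `φ(u, u) = 0`.
    have hu : X + C' X ∈ lieAlgebraOf n K := hmem _ (by rw [map_add, hCC, add_comm])
    have h1 := hX _ hu
    have h2 : killingForm ℝ (GroupLieAlgebra (𝓡 n) G) (X + C' X) (C' X) = 0 := by
      rw [← h1, ← killingForm_apply_of_inverse (C' : GroupLieAlgebra (𝓡 n) G →ₗ[ℝ] _)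
        (C' : GroupLieAlgebra (𝓡 n) G →ₗ[ℝ] _) hlie hCC hCC]
      simp [hCC, add_comm]
    by_contra hne
    have hne' : X + C' X ≠ 0 := fun h => hne (eq_neg_of_add_eq_zero_right h)
    have := killingForm_neg (X + C' X) hne'
    rw [map_add, h1, h2, add_zero] at this
    exact lt_irrefl _ this
  exact hmem _ (by rw [hlie, hneg X hX, hneg Y hY, lie_neg, neg_lie, neg_neg])

/-- The derivative of `t ↦ Ad (η t) Y` along a one-parameter group. -/
lemma hasDerivAt_apply_Ad_of_add {η : ℝ → G} {X : GroupLieAlgebra (𝓡 n) G}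
    (hadd : ∀ s t, η (s + t) = η s * η t)
    (hη : IsMIntegralCurve (I := 𝓡 n) η (mulInvariantVectorField X))
    (Y : GroupLieAlgebra (𝓡 n) G) (l : Module.Dual ℝ (GroupLieAlgebra (𝓡 n) G)) (t : ℝ) :
    HasDerivAt (fun s => l (Ad n (η s) Y)) (l (Ad n (η t) ⁅X, Y⁆)) t := by
  have h0 : η 0 = 1 := by simpa using hadd 0 0
  let A : GroupLieAlgebra (𝓡 n) G →ₗ[ℝ] GroupLieAlgebra (𝓡 n) G := Ad n (η t)
  have h1 := hasDerivAt_apply_Ad h0 hη Y (l ∘ₗ A)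
  rw [← sub_self t] at h1
  have h2 := HasDerivAt.scomp (h := fun s => s - t) t h1 ((hasDerivAt_id t).sub_const t)
  rw [one_smul] at h2
  refine h2.congr_of_eventuallyEq (Eventually.of_forall fun s => ?_)
  change l (Ad n (η s) Y) = l (Ad n (η t) (Ad n (η (s - t)) Y))
  rw [← Ad_mul_apply, ← hadd, add_sub_cancel]

lemma Ad_eq_self_of_lie_eq_zero {η : ℝ → G} {X : GroupLieAlgebra (𝓡 n) G}
    (hadd : ∀ s t, η (s + t) = η s * η t)
    (hη : IsMIntegralCurve (I := 𝓡 n) η (mulInvariantVectorField X))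
    {Y : GroupLieAlgebra (𝓡 n) G} (h : ⁅X, Y⁆ = 0) (t : ℝ) : Ad n (η t) Y = Y := by
  have h0 : η 0 = 1 := by simpa using hadd 0 0
  refine ext_dual fun l => ?_
  have hd : ∀ t, HasDerivAt (fun s => l (Ad n (η s) Y)) 0 t := fun t => by
    simpa [h] using hasDerivAt_apply_Ad_of_add hadd hη Y l t
  have := is_const_of_deriv_eq_zero (fun t => (hd t).differentiableAt) (fun t => (hd t).deriv) t 0
  simpa [h0, Ad_one_apply] using this

/-- If `(ad X)³ = -ad X`, then `Ad (exp (πX)) = 1 + 2 (ad X)²`. -/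
lemma Ad_pi_of_lie_lie_lie {η : ℝ → G} {X : GroupLieAlgebra (𝓡 n) G}
    (hadd : ∀ s t, η (s + t) = η s * η t)
    (hη : IsMIntegralCurve (I := 𝓡 n) η (mulInvariantVectorField X))
    (hX : ∀ Y : GroupLieAlgebra (𝓡 n) G, ⁅X, ⁅X, ⁅X, Y⁆⁆⁆ = -⁅X, Y⁆)
    (Y : GroupLieAlgebra (𝓡 n) G) : Ad n (η Real.pi) Y = Y + (2 : ℝ) • ⁅X, ⁅X, Y⁆⁆ := by
  have h0 : η 0 = 1 := by simpa using hadd 0 0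
  have key : ∀ Y : GroupLieAlgebra (𝓡 n) G,
      Ad n (η Real.pi) (Y + (2 : ℝ) • ⁅X, ⁅X, Y⁆⁆) = Y := by
    intro Y
    refine ext_dual fun l => ?_
    -- When `(ad X)³ = -ad X`, the inverse of `exp (s ad X)` is `1 - sin s · ad X + (1 - cos s) (ad
    -- X)²`. The product of the two is constant in `s`.
    have hd : ∀ t, HasDerivAt (fun s => l (Ad n (η s) Y) - Real.sin s * l (Ad n (η s) ⁅X, Y⁆)
        + (1 - Real.cos s) * l (Ad n (η s) ⁅X, ⁅X, Y⁆⁆)) 0 t := fun t => by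
      have d0 := hasDerivAt_apply_Ad_of_add hadd hη Y l t
      have d1 := (Real.hasDerivAt_sin t).mul (hasDerivAt_apply_Ad_of_add hadd hη ⁅X, Y⁆ l t)
      have d2 := ((Real.hasDerivAt_cos t).const_sub 1).mul
        (hasDerivAt_apply_Ad_of_add hadd hη ⁅X, ⁅X, Y⁆⁆ l t)
      refine ((d0.sub d1).add d2).congr_deriv ?_
      rw [hX, map_neg, map_neg]
      ring
    have := is_const_of_deriv_eq_zero (fun t => (hd t).differentiableAt)
      (fun t => (hd t).deriv) Real.pi 0
    simp only [Real.sin_pi, Real.cos_pi, Real.sin_zero, Real.cos_zero, h0, Ad_one_apply] at this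
    rw [map_add, map_smul, map_add, map_smul, smul_eq_mul]
    linarith
  -- The operator `1 + 2 (ad X)²` is its own inverse, since `(ad X)⁴ = -(ad X)²`.
  have hR : Y = (Y + (2 : ℝ) • ⁅X, ⁅X, Y⁆⁆) +
      (2 : ℝ) • ⁅X, ⁅X, Y + (2 : ℝ) • ⁅X, ⁅X, Y⁆⁆⁆⁆ := by
    simp only [lie_add, lie_smul, hX, lie_neg]
    module
  nth_rewrite 1 [hR]
  exact key _

/-- A torus is covered by one-parameter groups. -/
lemma IsTorus.exists_oneParam {S : Subgroup G} (hS : IsTorus n S) {s : G} (hs : s ∈ S) :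
    ∃ (η : ℝ → G) (X : GroupLieAlgebra (𝓡 n) G), (∀ s t, η (s + t) = η s * η t) ∧
      IsMIntegralCurve (I := 𝓡 n) η (mulInvariantVectorField X) ∧ (∀ t, η t ∈ S) ∧ η 1 = s := by
  obtain ⟨d, f, -, hf, rfl⟩ := hS
  obtain ⟨z, rfl⟩ := hs
  -- Angles of the coordinates of `z` define a line in `ℝ^d` whose image in the torus reaches `z` at
  -- time `1`.
  choose θ hθ using fun i => Circle.exp_surjective (z i)
  let η : ℝ → G := fun t => f fun i => Circle.exp ((t • θ) i)
  have hadd : ∀ s t, η (s + t) = η s * η t := by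
    intro s t
    change f _ = f _ * f _
    rw [← map_mul]
    refine congrArg f (funext fun i => ?_)
    simp [add_mul, Circle.exp_add]
  have hd : MDifferentiable 𝓘(ℝ, ℝ) (𝓡 n) η := by
    have h1 : MDifferentiable 𝓘(ℝ, ℝ) 𝓘(ℝ, Fin d → ℝ) (fun t : ℝ => t • θ) :=
      (show Differentiable ℝ (fun t : ℝ => t • θ) by fun_prop).mdifferentiable
    exact (hf.mdifferentiable (by simp)).comp h1
  obtain ⟨D, hD⟩ : ∃ D : ℝ →L[ℝ] EuclideanSpace ℝ (Fin n), HasMFDerivAt 𝓘(ℝ, ℝ) (𝓡 n) η 0 D :=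
    ⟨_, (hd 0).hasMFDerivAt⟩
  refine ⟨η, D 1, hadd, isMIntegralCurve_of_add hadd hD, fun t => ⟨_, rfl⟩, ?_⟩
  simp [η, hθ]

lemma IsTorus.mul_comm {S : Subgroup G} (hS : IsTorus n S) {s t : G} (hs : s ∈ S) (ht : t ∈ S) :
    s * t = t * s := by
  obtain ⟨d, f, -, hf, rfl⟩ := hS
  obtain ⟨z, rfl⟩ := hs
  obtain ⟨w, rfl⟩ := ht
  rw [← map_mul, ← map_mul, _root_.mul_comm]

lemma IsTorus.le_centralizer {S : Subgroup G} (hS : IsTorus n S) :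
    S ≤ Subgroup.centralizer (S : Set G) := fun _ hs =>
  Subgroup.mem_centralizer_iff.2 fun _ ht => hS.mul_comm ht hs

end FlagManifold
end

/-! ### The isotropy module: orthogonal splitting, irreducibility, rotation by the torus. -/

noncomputable section

namespace FlagManifold

open Set Filter Topology

section

variable {n : ℕ} {G : Type*} [TopologicalSpace G] [ChartedSpace (EuclideanSpace ℝ (Fin n)) G]
  [Group G] [LieGroup (𝓡 n) ∞ G] [T2Space G]

variable (n) in
/-- The vectors of the Lie algebra fixed by `Ad S`. -/
def fixedVectors (S : Subgroup G) : Submodule ℝ (GroupLieAlgebra (𝓡 n) G) where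
  carrier := {X | ∀ s ∈ S, Ad n s X = X}
  add_mem' hX hY s hs := by rw [map_add, hX s hs, hY s hs]
  zero_mem' s _ := map_zero _
  smul_mem' c X hX s hs := by rw [map_smul, hX s hs]

lemma mem_fixedVectors_iff {S : Subgroup G} {X : GroupLieAlgebra (𝓡 n) G} :
    X ∈ fixedVectors n S ↔ X ∈ lieAlgebraOf n (Subgroup.centralizer (S : Set G)) :=
  mem_lieAlgebraOf_centralizer_iff.symm

/-- If `[𝔪, 𝔪] ⊆ 𝔨`, then the invariant of de Siebenthal is empty. -/
lemma deSiebenthalInvariant_eq_empty {K : Subgroup G} {s : ℕ}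
    {V : Fin s → Submodule ℝ (GroupLieAlgebra (𝓡 n) G)} (hV : ∀ i, V i ≤ isotropyModule n K)
    (h : ∀ X ∈ isotropyModule n K, ∀ Y ∈ isotropyModule n K, ⁅X, Y⁆ ∈ lieAlgebraOf n K) :
    deSiebenthalInvariant V = ∅ := by
  rw [Set.eq_empty_iff_forall_notMem]
  rintro ⟨i, j, k⟩ ⟨X, hX, Y, hY, Z, hZ, hne⟩
  exact hne (hV k hZ _ (h X (hV i hX) Y (hV j hY)))

lemma killingForm_lie_eq_zero_of_deSiebenthalInvariant {s : ℕ}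
    {V : Fin s → Submodule ℝ (GroupLieAlgebra (𝓡 n) G)} (h : deSiebenthalInvariant V = ∅)
    {X Y Z : GroupLieAlgebra (𝓡 n) G} (hX : X ∈ ⨆ i, V i) (hY : Y ∈ ⨆ i, V i)
    (hZ : Z ∈ ⨆ i, V i) : killingForm ℝ (GroupLieAlgebra (𝓡 n) G) ⁅X, Y⁆ Z = 0 := by
  induction hX using Submodule.iSup_induction' with
  | zero => simp
  | add x x' _ _ hx hx' => rw [add_lie, map_add, LinearMap.add_apply, hx, hx', add_zero]
  | mem i x hx =>
    induction hY using Submodule.iSup_induction' with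
    | zero => simp
    | add y y' _ _ hy hy' => rw [lie_add, map_add, LinearMap.add_apply, hy, hy', add_zero]
    | mem j y hy =>
      induction hZ using Submodule.iSup_induction' with
      | zero => simp
      | add z z' _ _ hz hz' => rw [map_add, hz, hz', add_zero]
      | mem k z hz =>
        by_contra hne
        exact (Set.eq_empty_iff_forall_notMem.1 h (i, j, k)) ⟨x, hx, y, hy, z, hz, hne⟩

variable [CompactSpace G] [LieAlgebra.IsSimple ℝ (GroupLieAlgebra (𝓡 n) G)]

lemma killingForm_self_ne_zero (X : GroupLieAlgebra (𝓡 n) G) (hX : X ≠ 0) :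
    killingForm ℝ (GroupLieAlgebra (𝓡 n) G) X X ≠ 0 := (killingForm_neg X hX).ne

variable {S : Subgroup G}

lemma mem_isotropyModule_centralizer {X : GroupLieAlgebra (𝓡 n) G} :
    X ∈ isotropyModule n (Subgroup.centralizer (S : Set G)) ↔
      ∀ Y ∈ fixedVectors n S, killingForm ℝ (GroupLieAlgebra (𝓡 n) G) Y X = 0 := by
  simp only [mem_isotropyModule, mem_fixedVectors_iff]

variable (S) in
/-- The decomposition `𝔤 = 𝔨 + 𝔪`. -/
lemma exists_add_isotropyModule (X : GroupLieAlgebra (𝓡 n) G) :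
    ∃ Y ∈ fixedVectors n S, ∃ Z ∈ isotropyModule n (Subgroup.centralizer (S : Set G)),
      X = Y + Z := by
  obtain ⟨u, hu, v, hv, h⟩ := exists_add_of_definite
    (killingForm ℝ (GroupLieAlgebra (𝓡 n) G)) killingForm_symm killingForm_self_ne_zero
    (fixedVectors n S) X
  exact ⟨u, hu, v, mem_isotropyModule_centralizer.2 hv, h⟩

lemma eq_zero_of_mem_of_mem_isotropyModule {X : GroupLieAlgebra (𝓡 n) G}
    (hX : X ∈ fixedVectors n S)
    (hX' : X ∈ isotropyModule n (Subgroup.centralizer (S : Set G))) : X = 0 := by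
  by_contra hne
  exact killingForm_self_ne_zero X hne (mem_isotropyModule_centralizer.1 hX' X hX)

/-- Elements of `K` commute with `S`, so `Ad K` preserves the fixed vectors of `Ad S`; it also
preserves the Killing form, hence the orthogonal complement. -/
lemma isAdInvariant_isotropyModule : IsAdInvariant (Subgroup.centralizer (S : Set G))
    (isotropyModule n (Subgroup.centralizer (S : Set G))) := by
  intro a ha X hX
  rw [mem_isotropyModule_centralizer] at hX ⊢
  intro Y hY
  rw [← Ad_apply_inv_self a Y, killingForm_Ad]
  refine hX _ fun s hs => ?_
  have hsa : s * a⁻¹ = a⁻¹ * s :=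
    Subgroup.mem_centralizer_iff.1 (Subgroup.inv_mem _ ha) s hs
  rw [← Ad_mul_apply, hsa, Ad_mul_apply, hY s hs]

/-- An endomorphism that is symmetric for the Killing form and commutes with `Ad K` acts by a
scalar on an irreducible module. -/
lemma exists_smul_of_symmetric {K : Subgroup G} {W : Submodule ℝ (GroupLieAlgebra (𝓡 n) G)}
    (hW : IsAdIrreducible K W) (T : GroupLieAlgebra (𝓡 n) G →ₗ[ℝ] GroupLieAlgebra (𝓡 n) G)
    (hTW : ∀ X ∈ W, T X ∈ W)
    (hsymm : ∀ X Y, killingForm ℝ (GroupLieAlgebra (𝓡 n) G) (T X) Y =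
      killingForm ℝ (GroupLieAlgebra (𝓡 n) G) X (T Y))
    (hT : ∀ a ∈ K, ∀ X, T (Ad n a X) = Ad n a (T X)) : ∃ c : ℝ, ∀ X ∈ W, T X = c • X := by
  obtain ⟨hinv, hne, hirr⟩ := hW
  obtain ⟨c, v, hv, hv0, hTv⟩ := exists_eigenvector_of_symmetricOn
    (-killingForm ℝ (GroupLieAlgebra (𝓡 n) G)) hne
    (fun X Y => by simp only [LinearMap.neg_apply]; rw [killingForm_symm])
    (fun X hX => by simpa using killingForm_neg X hX) hTW
    (fun X _ Y _ => by simp only [LinearMap.neg_apply]; rw [hsymm])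
  -- The eigenspace in `W` is nonzero and `Ad K`-invariant, so it fills `W`.
  let U : Submodule ℝ (GroupLieAlgebra (𝓡 n) G) := W ⊓ LinearMap.ker (T - c • LinearMap.id)
  have hU : ∀ X, X ∈ U ↔ X ∈ W ∧ T X = c • X := by
    intro X
    simp [U, sub_eq_zero]
  have hUinv : IsAdInvariant K U := by
    intro a ha X hX
    rw [hU] at hX ⊢
    exact ⟨hinv a ha X hX.1, by rw [hT a ha, hX.2, map_smul]⟩
  rcases hirr U hUinv inf_le_left with h | h
  · have : v ∈ U := (hU v).2 ⟨hv, hTv⟩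
    rw [h] at this
    exact absurd ((Submodule.mem_bot ℝ).1 this) hv0
  · refine ⟨c, fun X hX => ?_⟩
    rw [← h] at hX
    exact ((hU X).1 hX).2

/-- If `𝔪 = 0`, then `Ad S` is trivial, so `S` is central in the connected group `G` and its
centralizer is everything. -/
lemma isotropyModule_ne_bot [ConnectedSpace G]
    (hK : Subgroup.centralizer (S : Set G) ≠ ⊤) :
    isotropyModule n (Subgroup.centralizer (S : Set G)) ≠ ⊥ := by
  intro hbot
  apply hK
  rw [eq_top_iff]
  intro x _
  rw [Subgroup.mem_centralizer_iff]
  intro s hs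
  refine commute_of_Ad_eq (n := n) (fun X => ?_) x
  obtain ⟨Y, hY, Z, hZ, rfl⟩ := exists_add_isotropyModule S X
  rw [hbot, Submodule.mem_bot] at hZ
  rw [hZ, add_zero]
  exact hY s hs

lemma isAdIrreducible_isotropyModule [ConnectedSpace G]
    (hK : Subgroup.centralizer (S : Set G) ≠ ⊤)
    (h : ∀ X ∈ isotropyModule n (Subgroup.centralizer (S : Set G)),
      ∀ Y ∈ isotropyModule n (Subgroup.centralizer (S : Set G)), ⁅X, Y⁆ ∈ fixedVectors n S) :
    IsAdIrreducible (Subgroup.centralizer (S : Set G))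
      (isotropyModule n (Subgroup.centralizer (S : Set G))) := by
  refine ⟨isAdInvariant_isotropyModule, isotropyModule_ne_bot hK, fun W hW hWm => ?_⟩
  by_cases hW0 : W = ⊥
  · exact Or.inl hW0
  · have hW' : ∀ X ∈ fixedVectors n S, ∀ Y ∈ W, ⁅X, Y⁆ ∈ W := fun X hX Y hY =>
      lie_mem_of_isAdInvariant hW (mem_fixedVectors_iff.1 hX) hY
    have hm : ∀ X, X ∈ isotropyModule n (Subgroup.centralizer (S : Set G)) ↔
        ∀ Y ∈ fixedVectors n S, killingForm ℝ (GroupLieAlgebra (𝓡 n) G) Y X = 0 := fun X =>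
      mem_isotropyModule_centralizer
    exact Or.inr (eq_of_lie_stable (L := GroupLieAlgebra (𝓡 n) G) killingForm_self_ne_zero
      hm h hWm hW0 hW')

/-- Some one-parameter group of the torus acts on the isotropy module by rotations. -/
lemma exists_lie_lie_eq_neg [ConnectedSpace G] (hS : IsTorus n S)
    (hirr : IsAdIrreducible (Subgroup.centralizer (S : Set G))
      (isotropyModule n (Subgroup.centralizer (S : Set G)))) :
    ∃ (η : ℝ → G) (X : GroupLieAlgebra (𝓡 n) G), (∀ s t, η (s + t) = η s * η t) ∧
      IsMIntegralCurve (I := 𝓡 n) η (mulInvariantVectorField X) ∧ (∀ t, η t ∈ S) ∧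
      ∀ Y ∈ isotropyModule n (Subgroup.centralizer (S : Set G)), ⁅X, ⁅X, Y⁆⁆ = -Y := by
  set K := Subgroup.centralizer (S : Set G) with hK
  set m := isotropyModule n K with hm
  obtain ⟨η, X, hadd, hη, hηS, Y, hY, hXY⟩ : ∃ (η : ℝ → G) (X : GroupLieAlgebra (𝓡 n) G),
      (∀ s t, η (s + t) = η s * η t) ∧
      IsMIntegralCurve (I := 𝓡 n) η (mulInvariantVectorField X) ∧ (∀ t, η t ∈ S) ∧
      ∃ Y ∈ m, ⁅X, Y⁆ ≠ 0 := by
    -- If every generator of `S` annihilated `𝔪`, then `Ad S` would fix `𝔪`, so `𝔪 ⊆ 𝔨` and `𝔪 = 0`.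
    by_contra! hcon
    refine hirr.2.1 ((Submodule.eq_bot_iff _).2 fun Y hY => ?_)
    refine eq_zero_of_mem_of_mem_isotropyModule (S := S) (fun s hs => ?_) hY
    obtain ⟨η, X, hadd, hη, hηS, rfl⟩ := hS.exists_oneParam hs
    exact Ad_eq_self_of_lie_eq_zero hadd hη (hcon η X hadd hη hηS Y hY) 1
  have h0 : η 0 = 1 := by simpa using hadd 0 0
  have hXK : ∀ a ∈ K, Ad n a X = X := fun a ha => Ad_eq_self_of_commute h0 hη fun t =>
    (Subgroup.mem_centralizer_iff.1 ha _ (hηS t)).symm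
  have hXk : X ∈ lieAlgebraOf n K :=
    mem_fixedVectors_iff.1 fun s hs => hXK s (hS.le_centralizer hs)
  have hXm : ∀ Y ∈ m, ⁅X, Y⁆ ∈ m := fun Y hY => lie_mem_of_isAdInvariant hirr.1 hXk hY
  obtain ⟨c, hc⟩ := exists_smul_of_symmetric hirr
    ((LieAlgebra.ad ℝ _ X : Module.End ℝ (GroupLieAlgebra (𝓡 n) G)) ∘ₗ LieAlgebra.ad ℝ _ X)
    (fun Y hY => hXm _ (hXm Y hY))
    (fun Y Z => by
      simp only [LinearMap.comp_apply, LieAlgebra.ad_apply]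
      rw [killingForm_lie_left', killingForm_lie_left', neg_neg])
    (fun a ha Y => by
      simp only [LinearMap.comp_apply, LieAlgebra.ad_apply]
      rw [Ad_lie, Ad_lie, hXK a ha])
  have hcX : ∀ Y ∈ m, ⁅X, ⁅X, Y⁆⁆ = c • Y := hc
  -- Skewness of `ad X` gives `c φ(Y, Y) = -φ([X, Y], [X, Y]) > 0`, while `φ(Y, Y) < 0`.
  have hcneg : c < 0 := by
    have h1 : c * killingForm ℝ (GroupLieAlgebra (𝓡 n) G) Y Y =
        -killingForm ℝ (GroupLieAlgebra (𝓡 n) G) ⁅X, Y⁆ ⁅X, Y⁆ := by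
      rw [← smul_eq_mul, ← LinearMap.smul_apply, ← map_smul, ← hcX Y hY, killingForm_lie_left']
    have h2 := killingForm_neg _ hXY
    have hY0 : Y ≠ 0 := fun h => hXY (by rw [h, lie_zero])
    have h3 := killingForm_neg _ hY0
    by_contra hcn
    nlinarith
  -- Rescaling the time of `η` by `r` replaces `X` by `r X`, whose `ad` squares to `r² c = -1` on
  -- `𝔪`.
  let r : ℝ := (Real.sqrt (-c))⁻¹
  have hr : r * r * c = -1 := by
    have : Real.sqrt (-c) * Real.sqrt (-c) = -c := Real.mul_self_sqrt (by linarith)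
    have h2 : r * r = (-c)⁻¹ := by rw [← mul_inv, this]
    rw [h2, inv_neg, neg_mul, inv_mul_cancel₀ hcneg.ne]
  refine ⟨η ∘ (· * r), r • X, fun s t => ?_, ?_, fun t => hηS _, fun Y hY => ?_⟩
  · simp only [Function.comp_apply, add_mul, hadd]
  · rw [mulInvariantVectorField_smul]
    exact hη.comp_mul r
  · rw [smul_lie, smul_lie, lie_smul, hcX Y hY, smul_smul, smul_smul, hr, neg_one_smul]

end

end FlagManifold
end

/-! ### The Hermitian structure, the symmetry `exp (πX)`, and the theorem. -/

noncomputable section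

namespace FlagManifold

open Set Filter Topology

section

variable {n : ℕ} {G : Type*} [TopologicalSpace G] [ChartedSpace (EuclideanSpace ℝ (Fin n)) G]
  [Group G] [LieGroup (𝓡 n) ∞ G]

lemma continuous_apply_Ad (B : LinearMap.BilinForm ℝ (GroupLieAlgebra (𝓡 n) G))
    (Y Z : GroupLieAlgebra (𝓡 n) G) : Continuous (fun a : G => B (Ad n a Y) Z) := by
  let B' : EuclideanSpace ℝ (Fin n) →ₗ[ℝ] EuclideanSpace ℝ (Fin n) →ₗ[ℝ] ℝ := B
  have h : Continuous (AdE n : G → _) := contMDiff_AdE.continuous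
  have h1 : ∀ W : EuclideanSpace ℝ (Fin n), Continuous (fun a : G => AdE n a W) :=
    fun W => h.clm_apply continuous_const
  exact ((B'.toContinuousBilinearMap).continuous.comp (h1 Y)).clm_apply continuous_const

/-- A continuous function that takes its values in `{2r : r ∈ ℕ}` on a preconnected set is
constant there. -/
lemma eq_zero_of_isPreconnected {α : Type*} [TopologicalSpace α] {s : Set α} (hs : IsPreconnected s)
    {f : α → ℝ} (hf : Continuous f) (h : ∀ x ∈ s, ∃ r : ℕ, f x = 2 * r) {x y : α} (hx : x ∈ s)
    (hy : y ∈ s) (hfx : f x = 0) : f y = 0 := by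
  obtain ⟨r, hr⟩ := h y hy
  rcases Nat.eq_zero_or_pos r with rfl | hpos
  · simpa using hr
  · have h1 : (1 : ℝ) ∈ Icc (f x) (f y) := by
      have : (1 : ℝ) ≤ r := by exact_mod_cast hpos
      constructor <;> linarith
    obtain ⟨z, hz, hz1⟩ := hs.intermediate_value hx hy hf.continuousOn h1
    obtain ⟨q, hq⟩ := h z hz
    have : (2 * q : ℝ) = 1 := by rw [← hq, hz1]
    norm_cast at this
    omega

variable [T2Space G] [CompactSpace G] [LieAlgebra.IsSimple ℝ (GroupLieAlgebra (𝓡 n) G)]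
  {S : Subgroup G} {X : GroupLieAlgebra (𝓡 n) G}

/-- If `X` is central in `𝔨` and `(ad X)² = -1` on `𝔪`, then `(ad X)³ = -ad X`. -/
lemma lie_lie_lie_eq_neg (hk : ∀ Y ∈ fixedVectors n S, ⁅X, Y⁆ = 0)
    (hX : ∀ Y ∈ isotropyModule n (Subgroup.centralizer (S : Set G)), ⁅X, ⁅X, Y⁆⁆ = -Y)
    (Y : GroupLieAlgebra (𝓡 n) G) : ⁅X, ⁅X, ⁅X, Y⁆⁆⁆ = -⁅X, Y⁆ := by
  obtain ⟨U, hU, Z, hZ, rfl⟩ := exists_add_isotropyModule S Y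
  rw [lie_add, hk U hU, zero_add, hX Z hZ, lie_neg]

/-- The Hermitian structure defined by `J = ad X` and the negative of the Killing form. -/
lemma exists_invariantComplexStructure
    (hXK : ∀ a ∈ Subgroup.centralizer (S : Set G), Ad n a X = X)
    (hXS : X ∈ fixedVectors n S)
    (hk : ∀ Y ∈ fixedVectors n S, ⁅X, Y⁆ = 0)
    (hX : ∀ Y ∈ isotropyModule n (Subgroup.centralizer (S : Set G)), ⁅X, ⁅X, Y⁆⁆ = -Y)
    (hmm : ∀ Y ∈ isotropyModule n (Subgroup.centralizer (S : Set G)),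
      ∀ Z ∈ isotropyModule n (Subgroup.centralizer (S : Set G)), ⁅Y, Z⁆ ∈ fixedVectors n S) :
    ∃ (J : GroupLieAlgebra (𝓡 n) G →ₗ[ℝ] GroupLieAlgebra (𝓡 n) G)
      (B : LinearMap.BilinForm ℝ (GroupLieAlgebra (𝓡 n) G)),
      IsInvariantComplexStructure (Subgroup.centralizer (S : Set G)) J ∧
      IsInvariantMetric (Subgroup.centralizer (S : Set G)) B ∧
      ∀ Y ∈ isotropyModule n (Subgroup.centralizer (S : Set G)),
        ∀ Z ∈ isotropyModule n (Subgroup.centralizer (S : Set G)), B (J Y) (J Z) = B Y Z := by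
  have hm : ∀ Y ∈ isotropyModule n (Subgroup.centralizer (S : Set G)),
      ⁅X, Y⁆ ∈ isotropyModule n (Subgroup.centralizer (S : Set G)) := fun Y hY =>
    lie_mem_of_isAdInvariant isAdInvariant_isotropyModule (mem_fixedVectors_iff.1 hXS) hY
  refine ⟨LieAlgebra.ad ℝ _ X, -killingForm ℝ _, ⟨?_, ?_, ?_, ?_, ?_⟩, ⟨?_, ?_, ?_⟩, ?_⟩
  · exact fun Y hY => hk Y (mem_fixedVectors_iff.2 hY)
  · exact hm
  · exact hX
  · intro a ha Y _
    simp only [LieAlgebra.ad_apply]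
    rw [Ad_lie, hXK a ha]
  · intro Y hY Z hZ
    simp only [LieAlgebra.ad_apply]
    -- Integrability is automatic: all four brackets lie in `[𝔪, 𝔪] ⊆ 𝔨`, where `J = ad X` vanishes.
    rw [hk _ (hmm _ (hm Y hY) _ hZ), hk _ (hmm _ hY _ (hm Z hZ)), sub_zero, sub_zero]
    exact mem_fixedVectors_iff.1 (Submodule.sub_mem _ (hmm _ (hm Y hY) _ (hm Z hZ))
      (hmm _ hY _ hZ))
  · intro Y _ Z _
    simp only [LinearMap.neg_apply]
    rw [killingForm_symm]
  · intro Y _ hY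
    simpa using killingForm_neg Y hY
  · intro a _ Y _ Z _
    simp only [LinearMap.neg_apply]
    rw [killingForm_Ad]
  · intro Y hY Z hZ
    simp only [LinearMap.neg_apply, LieAlgebra.ad_apply]
    rw [killingForm_lie_left', hX Z hZ, map_neg, neg_neg]

/-- The infinitesimal generators of the torus act on `𝔪` as multiples of `ad X`. -/
lemma exists_eq_smul_of_isAdIrreducible
    (hirr : IsAdIrreducible (Subgroup.centralizer (S : Set G))
      (isotropyModule n (Subgroup.centralizer (S : Set G))))
    (hXK : ∀ a ∈ Subgroup.centralizer (S : Set G), Ad n a X = X)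
    (hXS : X ∈ fixedVectors n S)
    (hk : ∀ Y ∈ fixedVectors n S, ⁅X, Y⁆ = 0)
    (hX : ∀ Y ∈ isotropyModule n (Subgroup.centralizer (S : Set G)), ⁅X, ⁅X, Y⁆⁆ = -Y)
    {Z : GroupLieAlgebra (𝓡 n) G}
    (hZK : ∀ a ∈ Subgroup.centralizer (S : Set G), Ad n a Z = Z)
    (hZS : Z ∈ fixedVectors n S)
    (hZk : ∀ Y ∈ fixedVectors n S, ⁅Z, Y⁆ = 0) : ∃ c : ℝ, Z = c • X := by
  have hXZ : ⁅X, Z⁆ = 0 := hk Z hZS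
  have hcomm : ∀ Y : GroupLieAlgebra (𝓡 n) G, ⁅X, ⁅Z, Y⁆⁆ = ⁅Z, ⁅X, Y⁆⁆ := by
    intro Y
    rw [leibniz_lie, hXZ, zero_lie, zero_add]
  have hm : ∀ T ∈ fixedVectors n S,
      ∀ Y ∈ isotropyModule n (Subgroup.centralizer (S : Set G)),
      ⁅T, Y⁆ ∈ isotropyModule n (Subgroup.centralizer (S : Set G)) := fun T hT Y hY =>
    lie_mem_of_isAdInvariant isAdInvariant_isotropyModule (mem_fixedVectors_iff.1 hT) hY
  -- The product `ad Z ∘ ad X` of commuting skew maps is symmetric and commutes with `Ad K`, hence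
  -- is a scalar `c` on `𝔪`. As `ad X` squares to `-1` there, `ad Z = -c · ad X` on `𝔪`; both vanish
  -- on `𝔨`, and simplicity gives `Z = -c X`.
  obtain ⟨c, hc⟩ := exists_smul_of_symmetric hirr
    ((LieAlgebra.ad ℝ _ Z : Module.End ℝ (GroupLieAlgebra (𝓡 n) G)) ∘ₗ LieAlgebra.ad ℝ _ X)
    (fun Y hY => hm Z hZS _ (hm X hXS Y hY))
    (fun Y W => by
      simp only [LinearMap.comp_apply, LieAlgebra.ad_apply]
      rw [killingForm_lie_left', killingForm_lie_left', neg_neg, hcomm])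
    (fun a ha Y => by
      simp only [LinearMap.comp_apply, LieAlgebra.ad_apply]
      rw [Ad_lie, Ad_lie, hXK a ha, hZK a ha])
  have hcZ : ∀ Y ∈ isotropyModule n (Subgroup.centralizer (S : Set G)),
    ⁅Z, ⁅X, Y⁆⁆ = c • Y := hc
  refine ⟨-c, ?_⟩
  rw [← sub_eq_zero]
  refine eq_zero_of_forall_lie_eq_zero fun Y => ?_
  obtain ⟨U, hU, W, hW, rfl⟩ := exists_add_isotropyModule S Y
  have h1 := hcZ _ (hm X hXS W hW)
  rw [hX W hW, lie_neg] at h1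
  rw [sub_lie, smul_lie, lie_add, lie_add, hk U hU, hZk U hU, zero_add, zero_add, neg_smul, ← h1,
    neg_neg, sub_self]

/-- Elements of the identity component of the centralizer of `exp (πX)` fix `X`. -/
lemma Ad_eq_self_of_mem_connectedComponentIn {a : G}
    (ha : ∀ Y : GroupLieAlgebra (𝓡 n) G, Ad n a Y = Y + (2 : ℝ) • ⁅X, ⁅X, Y⁆⁆)
    (hX : ∀ Y : GroupLieAlgebra (𝓡 n) G, ⁅X, ⁅X, ⁅X, Y⁆⁆⁆ = -⁅X, Y⁆) {x : G}
    (hx : x ∈ connectedComponentIn {x | a * x = x * a} 1) : Ad n x X = X := by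
  -- `Ad x` commutes with `Ad a = 1 + 2 (ad X)²`, hence with `(ad X)²`.
  have hsq : ∀ x, a * x = x * a → ∀ Y : GroupLieAlgebra (𝓡 n) G,
      Ad n x ⁅X, ⁅X, Y⁆⁆ = ⁅X, ⁅X, Ad n x Y⁆⁆ := by
    intro x hx Y
    have h : Ad n a (Ad n x Y) = Ad n x (Ad n a Y) := by
      rw [← Ad_mul_apply, hx, Ad_mul_apply]
    rw [ha, ha, map_add, map_smul] at h
    exact (smul_right_injective _ (two_ne_zero' ℝ) (add_left_cancel h)).symm
  -- `(ad X)²` annihilates `Ad x X` because it annihilates `X`; then `ad X = -(ad X)³` annihilates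
  -- it too.
  have hlie : ∀ x, a * x = x * a → ⁅X, Ad n x X⁆ = 0 := by
    intro x hx
    have h := hsq x hx X
    rw [lie_self, lie_zero, map_zero] at h
    have h2 := hX (Ad n x X)
    rw [← h, lie_zero] at h2
    exact neg_eq_zero.1 h2.symm
  have hy : ∀ x, a * x = x * a → ∀ Z : GroupLieAlgebra (𝓡 n) G,
      ⁅Ad n x X, ⁅Ad n x X, Z⁆⁆ = ⁅X, ⁅X, Z⁆⁆ := by
    intro x hx Z
    rw [← Ad_apply_inv_self x Z, ← Ad_lie, ← Ad_lie, hsq x hx]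
  have hmem : ∀ x ∈ connectedComponentIn {x | a * x = x * a} 1, a * x = x * a :=
    fun x hx => connectedComponentIn_subset {x | a * x = x * a} 1 hx
  have h1 : (1 : G) ∈ connectedComponentIn {x | a * x = x * a} 1 :=
    mem_connectedComponentIn (by simp)
  have h0 := eq_zero_of_isPreconnected isPreconnected_connectedComponentIn
    (f := fun x => killingForm ℝ (GroupLieAlgebra (𝓡 n) G) (Ad n x X) X -
      killingForm ℝ (GroupLieAlgebra (𝓡 n) G) X X)
    ((continuous_apply_Ad _ X X).sub continuous_const)
    (fun x hx => exists_nat_killingForm_sub (hlie x (hmem x hx)) hX (hy x (hmem x hx))) h1 hx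
    (by simp only [Ad_one_apply, sub_self])
  have h0' : killingForm ℝ (GroupLieAlgebra (𝓡 n) G) (Ad n x X) X =
      killingForm ℝ (GroupLieAlgebra (𝓡 n) G) X X := sub_eq_zero.1 h0
  by_contra hne
  -- `Ad x X` and `X` have equal Killing norm, and their product equals it, so their difference has
  -- norm zero.
  refine killingForm_self_ne_zero (Ad n x X - X) (sub_ne_zero.2 hne) ?_
  rw [map_sub, map_sub, LinearMap.sub_apply, LinearMap.sub_apply, killingForm_Ad,
    killingForm_symm X (Ad n x X), h0']
  ring

/-- The generators of the torus are fixed by `Ad K` and central in `𝔨`. -/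
lemma IsTorus.fixed_of_isMIntegralCurve (hS : IsTorus n S) {γ : ℝ → G}
    {Z : GroupLieAlgebra (𝓡 n) G} (h0 : γ 0 = 1)
    (hγ : IsMIntegralCurve (I := 𝓡 n) γ (mulInvariantVectorField Z)) (hγS : ∀ t, γ t ∈ S) :
    (∀ a ∈ Subgroup.centralizer (S : Set G), Ad n a Z = Z) ∧ Z ∈ fixedVectors n S ∧
      ∀ Y ∈ fixedVectors n S, ⁅Z, Y⁆ = 0 := by
  have h : ∀ a ∈ Subgroup.centralizer (S : Set G), Ad n a Z = Z := fun a ha =>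
    Ad_eq_self_of_commute h0 hγ fun t => (Subgroup.mem_centralizer_iff.1 ha _ (hγS t)).symm
  exact ⟨h, fun s hs => h s (hS.le_centralizer hs),
    fun Y hY => lie_eq_zero_of_Ad_eq h0 hγ fun t => hY _ (hγS t)⟩

/-- Conjugation by `exp (πX)` is the symmetry of the pair. -/
lemma isSymmetricPair_centralizer [ConnectedSpace G] (hS : IsTorus n S)
    (hirr : IsAdIrreducible (Subgroup.centralizer (S : Set G))
      (isotropyModule n (Subgroup.centralizer (S : Set G))))
    {η : ℝ → G} (hadd : ∀ s t, η (s + t) = η s * η t)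
    (hη : IsMIntegralCurve (I := 𝓡 n) η (mulInvariantVectorField X)) (hηS : ∀ t, η t ∈ S)
    (hX : ∀ Y ∈ isotropyModule n (Subgroup.centralizer (S : Set G)), ⁅X, ⁅X, Y⁆⁆ = -Y) :
    IsSymmetricPair n (Subgroup.centralizer (S : Set G)) := by
  have h0 : ∀ {γ : ℝ → G}, (∀ s t, γ (s + t) = γ s * γ t) → γ 0 = 1 := fun {γ} h => by
    simpa using h 0 0
  obtain ⟨hXK, hXS, hk⟩ := hS.fixed_of_isMIntegralCurve (h0 hadd) hη hηS
  have hX3 := lie_lie_lie_eq_neg hk hX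
  have ha := Ad_pi_of_lie_lie_lie hadd hη hX3
  -- `Ad (exp (πX))` squares to the identity, so `exp (πX)²` is central and conjugation by `exp
  -- (πX)` is an involution.
  have haa : ∀ x, (η Real.pi * η Real.pi) * x = x * (η Real.pi * η Real.pi) := by
    refine commute_of_Ad_eq (n := n) fun Y => ?_
    rw [Ad_mul_apply, ha, ha]
    simp only [lie_add, lie_smul, hX3, lie_neg]
    module
  have hset : {x : G | MulAut.conj (η Real.pi) x = x} = {x | η Real.pi * x = x * η Real.pi} := by
    ext x
    simp only [MulAut.conj_apply, mem_ofPred_eq, mul_inv_eq_iff_eq_mul]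
  refine ⟨MulAut.conj (η Real.pi), contMDiff_conj (η Real.pi), fun x => ?_, ?_, fun x hx => ?_⟩
  · have h := haa x
    rw [← MulAut.mul_apply, ← map_mul, MulAut.conj_apply, h, mul_inv_cancel_right]
  · intro x hx
    rw [hset] at hx
    have hxX := Ad_eq_self_of_mem_connectedComponentIn ha hX3 hx
    refine Subgroup.mem_centralizer_iff.2 fun s hs => ?_
    obtain ⟨γ, Z, hadd', hγ, hγS, rfl⟩ := hS.exists_oneParam hs
    obtain ⟨hZK, hZS, hZk⟩ := hS.fixed_of_isMIntegralCurve (h0 hadd') hγ hγS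
    -- Each `s ∈ S` lies on a one-parameter group generated by a multiple of `X`, so an `x` with `Ad
    -- x X = X` commutes with `s`.
    obtain ⟨c, rfl⟩ := exists_eq_smul_of_isAdIrreducible hirr hXK hXS hk hX hZK hZS hZk
    exact (commute_of_Ad_eq_self (h0 hadd') hγ (by rw [map_smul, hxX]) 1).symm
  · rw [MulAut.conj_apply, mul_inv_eq_iff_eq_mul]
    exact Subgroup.mem_centralizer_iff.1 hx _ (hηS _)

/-- If `φ([𝔪, 𝔪], 𝔪) = 0`, then `[𝔪, 𝔪] ⊆ 𝔨`. -/
lemma lie_mem_fixedVectors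
    (h : ∀ X ∈ isotropyModule n (Subgroup.centralizer (S : Set G)),
      ∀ Y ∈ isotropyModule n (Subgroup.centralizer (S : Set G)),
      ∀ Z ∈ isotropyModule n (Subgroup.centralizer (S : Set G)),
      killingForm ℝ (GroupLieAlgebra (𝓡 n) G) ⁅X, Y⁆ Z = 0)
    (X : GroupLieAlgebra (𝓡 n) G) (hX : X ∈ isotropyModule n (Subgroup.centralizer (S : Set G)))
    (Y : GroupLieAlgebra (𝓡 n) G) (hY : Y ∈ isotropyModule n (Subgroup.centralizer (S : Set G))) :
    ⁅X, Y⁆ ∈ fixedVectors n S := by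
  obtain ⟨U, hU, V, hV, hUV⟩ := exists_add_isotropyModule S ⁅X, Y⁆
  have h1 := h X hX Y hY V hV
  rw [hUV, map_add, LinearMap.add_apply, mem_isotropyModule_centralizer.1 hV U hU, zero_add] at h1
  have hV0 : V = 0 := by
    by_contra hne
    exact killingForm_self_ne_zero V hne h1
  rw [hUV, hV0, add_zero]
  exact hU

end

/-- The invariant of de Siebenthal of `G / K` is empty if and only if `G / K` is an isotropy
irreducible Hermitian symmetric space. -/
theorem deSiebenthalInvariant_eq_empty_iff {n : ℕ} {G : Type*} [TopologicalSpace G] [T2Space G]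
    [CompactSpace G] [ConnectedSpace G] [ChartedSpace (EuclideanSpace ℝ (Fin n)) G] [Group G]
    [LieGroup (𝓡 n) ∞ G] [LieAlgebra.IsSimple ℝ (GroupLieAlgebra (𝓡 n) G)]
    (S K : Subgroup G) (hS : IsTorus n S)
    (hK : K = Subgroup.centralizer (S : Set G)) (hK_ne_top : K ≠ ⊤)
    {s : ℕ} (V : Fin s → Submodule ℝ (GroupLieAlgebra (𝓡 n) G))
    (hV : IsIsotropyDecomposition K V) :
    deSiebenthalInvariant V = ∅ ↔
      IsHermitianSymmetric n K ∧
        IsAdIrreducible K (isotropyModule n K) := by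
  constructor
  · intro hT
    have hmmm : ∀ X ∈ isotropyModule n K, ∀ Y ∈ isotropyModule n K,
        ∀ Z ∈ isotropyModule n K, killingForm ℝ (GroupLieAlgebra (𝓡 n) G) ⁅X, Y⁆ Z = 0 := by
      rw [← hV.iSup_eq]
      exact fun X hX Y hY Z hZ => killingForm_lie_eq_zero_of_deSiebenthalInvariant hT hX hY hZ
    subst hK
    have hmm := lie_mem_fixedVectors hmmm
    have hirr := isAdIrreducible_isotropyModule hK_ne_top hmm
    obtain ⟨η, X, hadd, hη, hηS, hX⟩ := exists_lie_lie_eq_neg hS hirr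
    obtain ⟨hXK, hXS, hk⟩ := hS.fixed_of_isMIntegralCurve (by simpa using hadd 0 0) hη hηS
    exact ⟨⟨isSymmetricPair_centralizer hS hirr hadd hη hηS hX,
      exists_invariantComplexStructure hXK hXS hk hX hmm⟩, hirr⟩
  -- The converse needs only the symmetric pair.
  · rintro ⟨⟨hsymm, -⟩, -⟩
    refine deSiebenthalInvariant_eq_empty (K := K) (fun i => ?_)
      fun X hX Y hY => lie_mem_lieAlgebraOf_of_isSymmetricPair hsymm hX hY
    rw [← hV.iSup_eq]
    exact le_iSup V i

end FlagManifold

end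

theorem mainTheorem8 {n : ℕ} {G : Type*} [TopologicalSpace G] [T2Space G] [CompactSpace G]
    [ConnectedSpace G] [ChartedSpace (EuclideanSpace ℝ (Fin n)) G] [Group G]
    [LieGroup (𝓡 n) ∞ G] [LieAlgebra.IsSimple ℝ (GroupLieAlgebra (𝓡 n) G)]
    (S K : Subgroup G) (hS : FlagManifold.IsTorus n S)
    (hK : K = Subgroup.centralizer (S : Set G)) (hK_ne_top : K ≠ ⊤)
    {s : ℕ} (V : Fin s → Submodule ℝ (GroupLieAlgebra (𝓡 n) G))
    (hV : FlagManifold.IsIsotropyDecomposition K V) :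
    FlagManifold.deSiebenthalInvariant V = ∅ ↔
      FlagManifold.IsHermitianSymmetric n K ∧
        FlagManifold.IsAdIrreducible K (FlagManifold.isotropyModule n K) :=
  FlagManifold.deSiebenthalInvariant_eq_empty_iff S K hS hK hK_ne_top V hV
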